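/- Let $d \ge 1$ and let $k:\mathbb{R}^d\times\mathbb{R}^d\to\mathbb{R}$ be a continuous, bounded, translation-invariant positive semidefinite kernel with reproducing kernel Hilbert space $\mathcal H$, normalised so that its spectral measure $\Lambda$ is a probability measure, i.e. $k(x,y)=\int e^{i w^\top (x-y)}\,d\Lambda(w)$; write $k(x-y)=k(x,y)$. Suppose that for some $S,R>0$ $$\mathbb{E}_{w\sim\Lambda}[w_i^{2n}] \le \tfrac{1}{2}\, n!\, S^2 R^{n-2}\qquad\text{for all } i\in\{1,\dots,d\},\ n\ge 2 .$$ Let $\mathcal X\subset\mathbb{R}^d$ be compact and convex with diameter $|\mathcal X|$, and let $\mathcal X_\Delta=\{x-y : x,y\in\mathcal X\}$. Then $\sigma_\Lambda^2=\mathbb{E}[\|w\|_2^2]$, $L=\|\mathbb{E}[ww^\top]\|_2^{1/2}$ (spectral norm) and $E_{i,j}=\mathbb{E}[|w_iw_j|\,\|w\|_2]$ are finite, $z\mapsto k(z)$ is three times continuously differentiable, and $D_{i,j}=\sup_{z\in\mathcal X_\Delta}\|\nabla[\partial^2 k(z)/\partial z_i\partial z_j]\|_2$ is finite. For $m\ge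 1$ and sequences $\mathbf x=(x_1,\dots,x_{\ell_{\mathbf x}})$, $\mathbf y=(y_1,\dots,y_{\ell_{\mathbf y}})$ of finite length in $\mathcal X$, the level-$m$ discretized signature kernel is $k_{\mathrm{Sig},m}(\mathbf x,\mathbf y)=\langle S_m(\mathbf x),S_m(\mathbf y)\rangle_{\mathcal H^{\otimes m}}$ with $$S_m(\mathbf x)=\sum_{1\le i_1<\dots<i_m\le \ell_{\mathbf x}-1}\delta\varphi(x_{i_1})\otimes\dots\otimes\delta\varphi(x_{i_m}),\qquad \varphi(x)=k(x,\cdot)\in\mathcal H,\quad \delta\varphi(x_i)=\varphi(x_{i+1})-\varphi(x_i).$$ Let $\tilde d\ge1$, let $w^{(p)}_j$ ($1\le p\le m$, $1\le j\le\tilde d$) be independent random vectors with law $\Lambda$, and let $\tilde\varphi_p(x)=\tilde d^{-1/2}\big(\cos(w_j^{(p)\top}x),\sin(w_j^{(p)\top}x)\big)_{j\le\tilde d}\in\mathbb{R}^{2\tilde d}$. The level-$m$ random Fourier signature feature kernel $\tilde k_{\mathrm{Sig},m}$ is defined in the same way, with $\delta\tilde\varphi_1(x_{i_1})\otimes\dots\otimes\delta\tilde\varphi_m(x_{i_m})\in(\mathbb{R}^{2\tilde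 d})^{\otimes m}$ in place of $\delta\varphi(x_{i_1})\otimes\dots\otimes\delta\varphi(x_{i_m})$. Put $\|\mathbf x\|_{1\text{-var}}=\sum_{i=1}^{\ell_{\mathbf x}-1}\|x_{i+1}-x_i\|_2$. Then for every $V>0$, $m\ge1$, $\tilde d\ge 1$ and $\epsilon>0$, $$\mathbb{P}\Big[\sup_{\|\mathbf x\|_{1\text{-var}},\|\mathbf y\|_{1\text{-var}}\le V}\big|k_{\mathrm{Sig},m}(\mathbf x,\mathbf y)-\tilde k_{\mathrm{Sig},m}(\mathbf x,\mathbf y)\big|\ge\epsilon\Big]\le m\begin{cases}\Big(C\big(\tfrac{\beta}{\epsilon}\big)^{\frac{d}{d+1}}+a\Big)\exp\Big(-\tfrac{\tilde d}{2(d+1)(S^2+R)}\big(\tfrac{\epsilon}{\beta}\big)^{2}\Big), & \epsilon<\beta,\\[1ex]\Big(C\big(\tfrac{\beta}{\epsilon}\big)^{\frac{d}{(d+1)m}}+d\Big)\exp\Big(-\tfrac{\tilde d}{2(d+1)(S^2+R)}\big(\tfrac{\epsilon}{\beta}\big)^{\frac1m}\Big), & \epsilon\ge\beta,\end{cases}$$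 where the supremum is over finite sequences in $\mathcal X$, $C=2^{\frac1{d+1}}\,16\,|\mathcal X|^{\frac d{d+1}}\sum_{i,j=1}^d(D_{i,j}+E_{i,j})^{\frac d{d+1}}$, $\beta=\beta_{d,m,V}=m\big(2V^2\max(L^2,1)\max(\sigma_\Lambda^2,d)\big)^m$, and $a=d$ unless $d=m=1$, in which case $a=2$. -/

import Mathlib

open MeasureTheory ProbabilityTheory
open scoped TensorProduct Pointwise

noncomputable section

namespace RFSF

/-! ### Tensor powers of inner product spaces -/

/-- The canonical bilinear form on the `m`-th algebraic tensor power of an inner product space `G`: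
the bilinear extension of `⟨g₁ ⊗ ⋯ ⊗ gₘ, h₁ ⊗ ⋯ ⊗ hₘ⟩ = ⟨g₁, h₁⟩ ⋯ ⟨gₘ, hₘ⟩`
(see `tensorInner_tprod`). The Hilbert space tensor power is its completion; all the tensors
used below are finite sums of elementary tensors, hence lie in the algebraic tensor power. -/
def tensorInner (m : ℕ) (G : Type*) [NormedAddCommGroup G] [InnerProductSpace ℝ G] :
    (⨂[ℝ] _ : Fin m, G) →ₗ[ℝ] Module.Dual ℝ (⨂[ℝ] _ : Fin m, G) :=
  PiTensorProduct.dualDistrib ∘ₗ PiTensorProduct.map (fun _ => innerₗ G)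

theorem tensorInner_tprod (m : ℕ) (G : Type*) [NormedAddCommGroup G] [InnerProductSpace ℝ G]
    (g h : Fin m → G) :
    tensorInner m G (PiTensorProduct.tprod ℝ g) (PiTensorProduct.tprod ℝ h)
      = ∏ p, inner ℝ (g p) (h p) := by
  simp [tensorInner, PiTensorProduct.map_tprod, PiTensorProduct.dualDistrib_apply]

/-! ### Sequences, differences, 1-variation, discretized signatures -/

/-- Finite sequences `(x₁, …, x_ℓ)`, `ℓ ≥ 1`, of elements of `X`; the first component is `ℓ - 1`. -/
abbrev Sequence {E : Type*} (X : Set E) : Type _ := Σ n : ℕ, (Fin (n + 1) → X)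

/-- The difference `δ f(x_i) = f(x_{i+1}) - f(x_i)`. -/
def delta {E G : Type*} [AddCommGroup G] {X : Set E} (f : E → G) (x : Sequence X)
    (i : Fin x.1) : G :=
  f (x.2 i.succ) - f (x.2 i.castSucc)

/-- The 1-variation of a sequence. -/
def oneVar {E : Type*} [NormedAddCommGroup E] {X : Set E} (x : Sequence X) : ℝ :=
  ∑ i : Fin x.1, ‖delta id x i‖

open Classical in
/-- The strictly increasing multi-indices `i₁ < ⋯ < iₘ` with values in `{1, …, n}`. -/
def simplexIndex (m n : ℕ) : Finset (Fin m → Fin n) :=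
  Finset.univ.filter StrictMono

/-- The level-`m` discretized signature feature `∑_{i₁ < ⋯ < iₘ} δφ₁(x_{i₁}) ⊗ ⋯ ⊗ δφₘ(x_{iₘ})`,
where the `p`-th tensor factor uses the feature map `φ p`. -/
def sigFeature {E G : Type*} [NormedAddCommGroup G] [InnerProductSpace ℝ G] {X : Set E} {m : ℕ}
    (φ : Fin m → E → G) (x : Sequence X) : ⨂[ℝ] _ : Fin m, G :=
  ∑ i ∈ simplexIndex m x.1, PiTensorProduct.tprod ℝ (fun p => delta (φ p) x (i p))

/-- The inner product of two level-`m` discretized signature features. -/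
def sigInner {E G : Type*} [NormedAddCommGroup G] [InnerProductSpace ℝ G] {X : Set E} {m : ℕ}
    (φ : Fin m → E → G) (x y : Sequence X) : ℝ :=
  tensorInner m G (sigFeature φ x) (sigFeature φ y)

theorem sigInner_eq_sum {E G : Type*} [NormedAddCommGroup G] [InnerProductSpace ℝ G] {X : Set E}
    {m : ℕ} (φ : Fin m → E → G) (x y : Sequence X) :
    sigInner φ x y = ∑ i ∈ simplexIndex m x.1, ∑ j ∈ simplexIndex m y.1,
      ∏ p, inner ℝ (delta (φ p) x (i p)) (delta (φ p) y (j p)) := by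
  simp only [sigInner, sigFeature, map_sum, LinearMap.sum_apply, tensorInner_tprod]
  exact Finset.sum_comm

/-- The level-`m` discretized signature kernel of a reproducing kernel Hilbert space `H` of real
functions on `E`: every tensor factor uses the lift `x ↦ k(x, ·)`. -/
def sigKernel {E : Type*} (H : Type*) [NormedAddCommGroup H] [InnerProductSpace ℝ H]
    [CompleteSpace H] [RKHS ℝ H E ℝ] {X : Set E} (m : ℕ) (x y : Sequence X) : ℝ :=
  sigInner (fun _ : Fin m => fun u : E => RKHS.kerFun H u (1 : ℝ)) x y

/-! ### Random Fourier features and random Fourier signature features -/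

/-- The random Fourier feature map with weights `w₁, …, w_D`:
`x ↦ D^{-1/2} (cos ⟨w_j, x⟩, sin ⟨w_j, x⟩)_j ∈ ℝ^{2D}`. -/
def rffMap {d D : ℕ} (w : Fin D → EuclideanSpace ℝ (Fin d)) (x : EuclideanSpace ℝ (Fin d)) :
    EuclideanSpace ℝ (Fin D ⊕ Fin D) :=
  WithLp.toLp 2 (fun s => (1 / Real.sqrt D) *
    Sum.elim (fun j => Real.cos (inner ℝ (w j) x)) (fun j => Real.sin (inner ℝ (w j) x)) s)

/-- The level-`m` random Fourier signature feature kernel: the `p`-th tensor factor uses the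
random Fourier feature map with weights `W p`. -/
def rfsfKernel {d D m : ℕ} (W : Fin m → Fin D → EuclideanSpace ℝ (Fin d))
    {X : Set (EuclideanSpace ℝ (Fin d))} (x y : Sequence X) : ℝ :=
  sigInner (fun p => rffMap (W p)) x y

/-- The uniform error over all sequences in `X` of 1-variation at most `V`,
a supremum in `[0, ∞]`. -/
def uniformError {d D m : ℕ} (H : Type*) [NormedAddCommGroup H] [InnerProductSpace ℝ H]
    [CompleteSpace H] [RKHS ℝ H (EuclideanSpace ℝ (Fin d)) ℝ]
    (X : Set (EuclideanSpace ℝ (Fin d))) (V : ℝ)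
    (W : Fin m → Fin D → EuclideanSpace ℝ (Fin d)) : ENNReal :=
  ⨆ (x : Sequence X) (y : Sequence X) (_ : oneVar x ≤ V) (_ : oneVar y ≤ V),
    ENNReal.ofReal |sigKernel H m x y - rfsfKernel W x y|

/-! ### Spectral measure, moment condition, constants -/

/-- `Λ` is the spectral measure of `k`: `k(x, y) = ∫ exp(i ⟨w, x - y⟩) dΛ(w)`. -/
def IsSpectralMeasure {d : ℕ} (k : EuclideanSpace ℝ (Fin d) → EuclideanSpace ℝ (Fin d) → ℝ)
    (Λ : Measure (EuclideanSpace ℝ (Fin d))) : Prop :=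
  ∀ x y, (k x y : ℂ) = ∫ w, Complex.exp (Complex.I * (inner ℝ w (x - y) : ℝ)) ∂Λ

/-- The Bernstein moment condition `E[w_i^{2n}] ≤ n! S² R^{n-2} / 2` for all `i` and `n ≥ 2`. -/
def BernsteinCondition {d : ℕ} (Λ : Measure (EuclideanSpace ℝ (Fin d))) (S R : ℝ) : Prop :=
  ∀ (i : Fin d) (n : ℕ), 2 ≤ n →
    Integrable (fun w => w i ^ (2 * n)) Λ ∧
      ∫ w, w i ^ (2 * n) ∂Λ ≤ (n.factorial : ℝ) * S ^ 2 * R ^ (n - 2) / 2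

/-- `σ_Λ² = E[‖w‖²]`. -/
def sigmaSq {d : ℕ} (Λ : Measure (EuclideanSpace ℝ (Fin d))) : ℝ := ∫ w, ‖w‖ ^ 2 ∂Λ

/-- The second moment matrix `E[w wᵀ]`. -/
def momentMatrix {d : ℕ} (Λ : Measure (EuclideanSpace ℝ (Fin d))) : Matrix (Fin d) (Fin d) ℝ :=
  Matrix.of fun i j => ∫ w, w i * w j ∂Λ

/-- `L = ‖E[w wᵀ]‖₂^{1/2}`, with the spectral norm. -/
def lipConst {d : ℕ} (Λ : Measure (EuclideanSpace ℝ (Fin d))) : ℝ :=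
  Real.sqrt ‖Matrix.toEuclideanCLM (n := Fin d) (𝕜 := ℝ) (momentMatrix Λ)‖

/-- `E_{i,j} = E[|w_i w_j| ‖w‖]`. -/
def momentE {d : ℕ} (Λ : Measure (EuclideanSpace ℝ (Fin d))) (i j : Fin d) : ℝ :=
  ∫ w, |w i * w j| * ‖w‖ ∂Λ

/-- The partial derivative `∂f/∂z_i`. -/
def partialDeriv {d : ℕ} (i : Fin d) (f : EuclideanSpace ℝ (Fin d) → ℝ)
    (z : EuclideanSpace ℝ (Fin d)) : ℝ :=
  fderiv ℝ f z (EuclideanSpace.single i 1)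

/-- The norm `‖∇[∂²κ/∂z_i∂z_j](z)‖`, where `κ(x - y) = k(x, y)`. -/
def gradNorm {d : ℕ} (k : EuclideanSpace ℝ (Fin d) → EuclideanSpace ℝ (Fin d) → ℝ)
    (i j : Fin d) (z : EuclideanSpace ℝ (Fin d)) : ℝ :=
  ‖gradient (partialDeriv i (partialDeriv j (fun u => k u 0))) z‖

/-- `D_{i,j}`, the supremum of `gradNorm k i j` over `X - X`. -/
def derivD {d : ℕ} (k : EuclideanSpace ℝ (Fin d) → EuclideanSpace ℝ (Fin d) → ℝ)
    (X : Set (EuclideanSpace ℝ (Fin d))) (i j : Fin d) : ℝ :=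
  sSup (gradNorm k i j '' (X - X))

/-- `C_{d,X} = 2^{1/(d+1)} 16 |X|^{d/(d+1)} ∑_{i,j} (D_{i,j} + E_{i,j})^{d/(d+1)}`. -/
def constC {d : ℕ} (k : EuclideanSpace ℝ (Fin d) → EuclideanSpace ℝ (Fin d) → ℝ)
    (Λ : Measure (EuclideanSpace ℝ (Fin d))) (X : Set (EuclideanSpace ℝ (Fin d))) : ℝ :=
  (2 : ℝ) ^ ((1 : ℝ) / (d + 1)) * 16 * Metric.diam X ^ ((d : ℝ) / (d + 1)) *
    ∑ i : Fin d, ∑ j : Fin d, (derivD k X i j + momentE Λ i j) ^ ((d : ℝ) / (d + 1))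

/-- `β_{d,m,V} = m (2 V² (L² ∨ 1) (σ_Λ² ∨ d))^m`. -/
def constBeta {d : ℕ} (Λ : Measure (EuclideanSpace ℝ (Fin d))) (m : ℕ) (V : ℝ) : ℝ :=
  m * (2 * V ^ 2 * max (lipConst Λ ^ 2) 1 * max (sigmaSq Λ) d) ^ m

/-- The additive constant of the bound for `ε < β`: `d`, except that it is `2` when `d = m = 1`. -/
def addConst (d m : ℕ) : ℝ := if d = 1 ∧ m = 1 then 2 else d

/-- The tail bound, with `b = β_{d,m,V}`, `C = C_{d,X}` and `D` the number of random
frequencies in each feature map. -/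
def tailBound (d m D : ℕ) (C S R b ε : ℝ) : ℝ :=
  if ε < b then
    m * ((C * (b / ε) ^ ((d : ℝ) / (d + 1)) + addConst d m) *
      Real.exp (-(D / (2 * (d + 1) * (S ^ 2 + R)) * (ε / b) ^ 2)))
  else
    m * ((C * (b / ε) ^ ((d : ℝ) / ((d + 1) * m)) + d) *
      Real.exp (-(D / (2 * (d + 1) * (S ^ 2 + R)) * (ε / b) ^ ((1 : ℝ) / m))))

end RFSF

end

/-!
Both kernels are translation invariant in each tensor factor: the inner products of the two feature
maps are `k(x - y) = ∫ cos ⟨w, x - y⟩ dΛ(w)` and the same integral against the empirical measure of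
the random frequencies. Hence the inner product of two increments is a mixed second difference of
such an integral, and it is bounded by the step lengths times the second moment of the measure.
The difference of the two inner products is bounded by the step lengths times `d` times the largest
entry, over `X - X`, of the difference of the two Hessians (`abs_secondDiff_trigMoment_sub_le`).
Telescoping the products over the `m` tensor factors turns this into a deterministic estimate
for the signature kernels (`abs_sigInner_sub_sigInner_le`, `uniformError_lt`): the error is below
`ε` once every entry `hessDev` of the Hessian deviation is small on `X - X` and the empirical
second moments are not much larger than `σ_Λ²`.

At a fixed point each entry is a centered empirical mean of `w_i w_j cos ⟨w, z⟩`, to which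
Bernstein's inequality applies (`BernsteinMoments.measure_empMean_ge_le`). For the supremum over
`X - X`, the union bound over a finite net is combined with Markov's inequality for the
random Lipschitz constant, whose mean is at most `D_{i,j} + E_{i,j}`. Optimising the mesh gives the
powers `d / (d + 1)` (`measure_exists_ge_le`).

The optimal mesh can exceed the size of `X - X`. The event that the deviation is large at the
origin is therefore split off; it contributes `2 exp(-B)` per entry, where `exp(-B / (d + 1))` is
the exponential factor of the final bound. The diagonal deviations at the origin also control the
empirical second moments (`empMean_norm_sq`). Altogether this costs `2 d² x^{d+1}` with
`x = exp(-B / (d + 1))`, and whenever the final bound is less than one this is at most the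
additive term `a x` (`two_mul_sq_mul_pow_le`). The only exception is `d = m = 1` with a large
deviation, where the lower tail at the origin is empty because empirical second moments are
nonnegative (`measure_uniformError_ge_le_of_dim_one`).
-/

noncomputable section

namespace RFSF

/-! ### Bernstein's inequality for empirical means -/

section Bernstein

variable {α : Type*} [MeasurableSpace α] {μ : Measure α} [IsProbabilityMeasure μ]

/-- The moments of order `n ≥ 2` of `|φ|` under `μ` are finite and at most `n! S² R^{n-2} / 2`.
The moments are not centered, which is enough for Bernstein's inequality. -/
def BernsteinMoments (φ : α → ℝ) (μ : Measure α) (S R : ℝ) : Prop :=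
  ∀ n : ℕ, 2 ≤ n → Integrable (fun a => |φ a| ^ n) μ ∧
    ∫ a, |φ a| ^ n ∂μ ≤ (n.factorial : ℝ) * S ^ 2 * R ^ (n - 2) / 2

theorem BernsteinMoments.integrable {φ : α → ℝ} {S R : ℝ} (h : BernsteinMoments φ μ S R)
    (hφ : AEStronglyMeasurable φ μ) : Integrable φ μ := by
  have h2 : MemLp φ 2 μ := by
    rw [memLp_two_iff_integrable_sq hφ]
    simpa using (h 2 le_rfl).1
  exact h2.integrable (by norm_num)

omit [IsProbabilityMeasure μ] in
theorem BernsteinMoments.neg {φ : α → ℝ} {S R : ℝ} (h : BernsteinMoments φ μ S R) :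
    BernsteinMoments (fun a => -φ a) μ S R := by
  simpa [BernsteinMoments] using h

/-- The moment generating function is integrated term by term: the terms of order `n ≥ 2` of the
exponential series are dominated by a geometric series of ratio `l R`. -/
theorem BernsteinMoments.integral_exp_le {φ : α → ℝ} {S R : ℝ} (h : BernsteinMoments φ μ S R)
    (hφ : AEStronglyMeasurable φ μ) (hR : 0 < R) {l : ℝ} (hl : 0 ≤ l) (hlR : l * R < 1) :
    Integrable (fun a => Real.exp (l * φ a)) μ ∧
      ∫ a, Real.exp (l * φ a) ∂μ
        ≤ Real.exp (l * ∫ a, φ a ∂μ + S ^ 2 * l ^ 2 / (2 * (1 - l * R))) := by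
  have hint := h.integrable hφ
  set F : ℕ → α → ℝ := fun n a => (l * φ a) ^ n / n.factorial with hF
  have hpow : ∀ n, Integrable (fun a => |φ a| ^ n) μ := by
    intro n
    match n with
    | 0 => simp
    | 1 => simpa using hint.abs
    | n + 2 => exact (h (n + 2) (by omega)).1
  have hFabs : ∀ n a, ‖F n a‖ = l ^ n / n.factorial * |φ a| ^ n := by
    intro n a
    simp only [hF, norm_div, norm_pow, norm_mul, Real.norm_eq_abs, abs_of_nonneg hl, Nat.abs_cast]
    ring
  have hFint : ∀ n, Integrable (F n) μ := by
    intro n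
    refine ((hpow n).const_mul (l ^ n / n.factorial)).mono' ?_ ?_
    · exact ((hφ.const_mul l).pow n).mul_const _
    · exact Filter.Eventually.of_forall fun a => (hFabs n a).le
  have hFnorm : ∀ n, ∫ a, ‖F (n + 2) a‖ ∂μ ≤ S ^ 2 * l ^ 2 / 2 * (l * R) ^ n := by
    intro n
    simp_rw [hFabs, integral_const_mul]
    have := (h (n + 2) (by omega)).2
    have hf : (0 : ℝ) < (n + 2).factorial := by positivity
    calc l ^ (n + 2) / (n + 2).factorial * ∫ a, |φ a| ^ (n + 2) ∂μ
        ≤ l ^ (n + 2) / (n + 2).factorial * ((n + 2).factorial * S ^ 2 * R ^ (n + 2 - 2) / 2) := by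
          gcongr
      _ = _ := by
          rw [Nat.add_sub_cancel]; field_simp; ring
  have hgeo : Summable fun n : ℕ => S ^ 2 * l ^ 2 / 2 * (l * R) ^ n :=
    (summable_geometric_of_lt_one (by positivity) hlR).mul_left _
  have hsum2 : Summable fun n => ∫ a, ‖F (n + 2) a‖ ∂μ :=
    Summable.of_nonneg_of_le (fun n => integral_nonneg fun a => norm_nonneg _) hFnorm hgeo
  have hsum : Summable fun n => ∫ a, ‖F n a‖ ∂μ := (summable_nat_add_iff 2).1 hsum2
  have hexp : ∀ a, HasSum (fun n => F n a) (Real.exp (l * φ a)) := by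
    intro a
    rw [Real.exp_eq_exp_ℝ]
    exact NormedSpace.expSeries_div_hasSum_exp (l * φ a)
  have hexpabs : ∀ a, HasSum (fun n => ‖F n a‖) (Real.exp |l * φ a|) := by
    intro a
    rw [Real.exp_eq_exp_ℝ]
    convert! NormedSpace.expSeries_div_hasSum_exp |l * φ a| using 2 with n
    rw [hF, norm_div, norm_pow, Real.norm_eq_abs, Real.norm_natCast]
  have hI : Integrable (fun a => Real.exp |l * φ a|) μ := by
    refine ⟨(Real.continuous_exp.comp continuous_abs).comp_aestronglyMeasurable
      (hφ.const_mul l), ?_⟩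
    rw [hasFiniteIntegral_iff_ofReal (Filter.Eventually.of_forall fun a => (Real.exp_pos _).le)]
    have : ∀ a, ENNReal.ofReal (Real.exp |l * φ a|) = ∑' n, ENNReal.ofReal ‖F n a‖ := by
      intro a
      rw [← (hexpabs a).tsum_eq, ENNReal.ofReal_tsum_of_nonneg (fun n => norm_nonneg _)
        (hexpabs a).summable]
    simp_rw [this]
    rw [lintegral_tsum fun n => (hFint n).norm.aestronglyMeasurable.aemeasurable.ennreal_ofReal]
    have hlint : ∀ n, ∫⁻ a, ENNReal.ofReal ‖F n a‖ ∂μ = ENNReal.ofReal (∫ a, ‖F n a‖ ∂μ) :=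
      fun n => (ofReal_integral_eq_lintegral_ofReal (hFint n).norm
        (Filter.Eventually.of_forall fun a => norm_nonneg _)).symm
    rw [tsum_congr hlint]
    rw [← ENNReal.ofReal_tsum_of_nonneg (fun n => integral_nonneg fun a => norm_nonneg _) hsum]
    exact ENNReal.ofReal_lt_top
  refine ⟨?_, ?_⟩
  · refine hI.mono' (Real.continuous_exp.comp_aestronglyMeasurable (hφ.const_mul l)) ?_
    refine Filter.Eventually.of_forall fun a => ?_
    rw [Real.norm_eq_abs, abs_of_pos (Real.exp_pos _)]
    exact Real.exp_le_exp.2 (le_abs_self _)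
  · have hs := hasSum_integral_of_summable_integral_norm hFint hsum
    simp_rw [fun a => (hexp a).tsum_eq] at hs
    have hs2 : Summable fun n => ∫ a, F (n + 2) a ∂μ := (summable_nat_add_iff 2).2 hs.summable
    rw [← hs.tsum_eq, ← hs.summable.sum_add_tsum_nat_add 2]
    have htail : ∑' n, ∫ a, F (n + 2) a ∂μ ≤ S ^ 2 * l ^ 2 / (2 * (1 - l * R)) := by
      calc ∑' n, ∫ a, F (n + 2) a ∂μ ≤ ∑' n, S ^ 2 * l ^ 2 / 2 * (l * R) ^ n := by
            refine hs2.tsum_le_tsum (fun n => ?_) hgeo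
            exact ((Real.le_norm_self _).trans (norm_integral_le_integral_norm _)).trans (hFnorm n)
        _ = _ := by
            rw [tsum_mul_left, tsum_geometric_of_lt_one (by positivity) hlR, div_mul_eq_div_div,
              div_eq_mul_inv (_ / 2)]
    have hhead : ∑ n ∈ Finset.range 2, ∫ a, F n a ∂μ = 1 + l * ∫ a, φ a ∂μ := by
      simp [Finset.sum_range_succ, hF, integral_const_mul]
    rw [hhead]
    have := Real.add_one_le_exp (l * ∫ a, φ a ∂μ + S ^ 2 * l ^ 2 / (2 * (1 - l * R)))
    linarith

/-- The empirical mean `D⁻¹ ∑ φ(w_l)` of `φ` over the sample `w`. -/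
def empMean {α : Type*} {D : ℕ} (φ : α → ℝ) (w : Fin D → α) : ℝ := 1 / (D : ℝ) * ∑ l, φ (w l)

/-- One-sided Bernstein inequality for the empirical mean of an i.i.d. sample. -/
theorem BernsteinMoments.measure_empMean_ge_le {φ : α → ℝ} {S R : ℝ}
    (h : BernsteinMoments φ μ S R) (hφ : Measurable φ) (hS : 0 < S) (hR : 0 < R)
    {Ω : Type*} [MeasurableSpace Ω] {P : Measure Ω} [IsProbabilityMeasure P] {D : ℕ} (hD : 1 ≤ D)
    {W : Fin D → Ω → α} (hW : ∀ l, Measurable (W l)) (hind : iIndepFun W P)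
    (hlaw : ∀ l, P.map (W l) = μ) {τ : ℝ} (hτ : 0 < τ) :
    P {ω | τ ≤ empMean φ (fun l => W l ω) - ∫ a, φ a ∂μ}
      ≤ ENNReal.ofReal (Real.exp (-(D * (τ ^ 2 / (2 * (S ^ 2 + R * τ)))))) := by
  have hden : 0 < S ^ 2 + R * τ := by positivity
  -- The minimiser of the Chernoff exponent; with it the exponent is exactly `-D l τ / 2`.
  set l : ℝ := τ / (S ^ 2 + R * τ) with hldef
  have hl : 0 ≤ l := by positivity
  have hlR' : 1 - l * R = S ^ 2 / (S ^ 2 + R * τ) := by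
    rw [hldef]; field_simp; ring
  have hlR : l * R < 1 := by
    have : 0 < S ^ 2 / (S ^ 2 + R * τ) := by positivity
    linarith
  obtain ⟨hint, hle⟩ := h.integral_exp_le hφ.aestronglyMeasurable hR hl hlR
  set X : Fin D → Ω → ℝ := fun i ω => φ (W i ω) with hX
  have hXm : ∀ i, Measurable (X i) := fun i => hφ.comp (hW i)
  have hXind : iIndepFun X P := hind.comp (fun _ => φ) (fun _ => hφ)
  have hXint : ∀ i, Integrable (fun ω => Real.exp (l * X i ω)) P := by
    intro i
    rw [← hlaw i] at hint
    exact hint.comp_measurable (hW i)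
  have hmgf : ∀ i, mgf (X i) P l = ∫ a, Real.exp (l * φ a) ∂μ := by
    intro i
    rw [mgf, ← hlaw i, integral_map (hW i).aemeasurable]
    exact (by fun_prop : Measurable fun a => Real.exp (l * φ a)).aestronglyMeasurable
  have hD' : (0 : ℝ) < D := by exact_mod_cast hD
  have hch := measure_ge_le_exp_mul_mgf (μ := P) (X := ∑ i, X i) (D * (τ + ∫ a, φ a ∂μ)) hl
    (hXind.integrable_exp_mul_sum hXm (s := Finset.univ) fun i _ => hXint i)
  rw [hXind.mgf_sum hXm] at hch
  simp_rw [hmgf] at hch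
  rw [Finset.prod_const, Finset.card_univ, Fintype.card_fin] at hch
  have hset : {ω | τ ≤ empMean φ (fun l => W l ω) - ∫ a, φ a ∂μ}
      = {ω | D * (τ + ∫ a, φ a ∂μ) ≤ (∑ i, X i) ω} := by
    ext ω
    simp only [Set.mem_ofPred_eq, empMean, Finset.sum_apply, hX]
    rw [le_sub_iff_add_le, one_div, ← div_eq_inv_mul, le_div_iff₀ hD', mul_comm]
  rw [hset, ← ofReal_measureReal]
  refine ENNReal.ofReal_le_ofReal (hch.trans ?_)
  calc Real.exp (-l * (D * (τ + ∫ a, φ a ∂μ))) * (∫ a, Real.exp (l * φ a) ∂μ) ^ D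
      ≤ Real.exp (-l * (D * (τ + ∫ a, φ a ∂μ))) *
        (Real.exp (l * ∫ a, φ a ∂μ + S ^ 2 * l ^ 2 / (2 * (1 - l * R)))) ^ D := by
        gcongr
    _ = _ := by
        rw [← Real.exp_nat_mul, ← Real.exp_add]
        congr 1
        rw [hlR', hldef]
        field_simp
        ring

theorem BernsteinMoments.measure_abs_empMean_ge_le {φ : α → ℝ} {S R : ℝ}
    (h : BernsteinMoments φ μ S R) (hφ : Measurable φ) (hS : 0 < S) (hR : 0 < R)
    {Ω : Type*} [MeasurableSpace Ω] {P : Measure Ω} [IsProbabilityMeasure P] {D : ℕ} (hD : 1 ≤ D)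
    {W : Fin D → Ω → α} (hW : ∀ l, Measurable (W l)) (hind : iIndepFun W P)
    (hlaw : ∀ l, P.map (W l) = μ) {τ : ℝ} (hτ : 0 < τ) :
    P {ω | τ ≤ |empMean φ (fun l => W l ω) - ∫ a, φ a ∂μ|}
      ≤ ENNReal.ofReal (2 * Real.exp (-(D * (τ ^ 2 / (2 * (S ^ 2 + R * τ)))))) := by
  have h1 := h.measure_empMean_ge_le hφ hS hR hD hW hind hlaw hτ
  have h2 := h.neg.measure_empMean_ge_le hφ.neg hS hR hD hW hind hlaw hτ
  rw [two_mul, ENNReal.ofReal_add (Real.exp_pos _).le (Real.exp_pos _).le]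
  refine (measure_mono ?_).trans ((measure_union_le _ _).trans (add_le_add h1 h2))
  intro ω hω
  simp only [Set.mem_ofPred_eq, Set.mem_union] at hω ⊢
  refine (le_abs.1 hω).imp id fun h => h.trans_eq ?_
  simp only [empMean, Finset.sum_neg_distrib, integral_neg]
  ring

end Bernstein

/-! ### Finite nets in bounded sets -/

section Covering

open Metric Module

variable {F : Type*} [NormedAddCommGroup F] [NormedSpace ℝ F] [FiniteDimensional ℝ F]

open scoped Function in
/-- The balls of radius `r / 2` around the points of an `r`-separated set are disjoint and lie in
the ball of radius `ρ + r / 2`, so their number is bounded by the ratio of volumes. -/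
theorem card_le_of_separated {r ρ : ℝ} (hr : 0 < r) (hρ : 0 ≤ ρ) (s : Finset F)
    (hs : ∀ c ∈ s, ‖c‖ ≤ ρ) (hsep : ∀ c ∈ s, ∀ c' ∈ s, c ≠ c' → r ≤ ‖c - c'‖) :
    (s.card : ℝ) ≤ (1 + 2 * ρ / r) ^ finrank ℝ F := by
  borelize F
  let μ : Measure F := Measure.addHaar
  have hr2 : 0 < r / 2 := by positivity
  have hρ2 : 0 < ρ + r / 2 := by positivity
  have hdisj : Set.Pairwise (s : Set F) (Disjoint on fun c => ball (c : F) (r / 2)) := by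
    rintro c hc c' hc' hne
    apply ball_disjoint_ball
    rw [dist_eq_norm]
    linarith [hsep c hc c' hc' hne]
  have hsub : (⋃ c ∈ s, ball (c : F) (r / 2)) ⊆ ball (0 : F) (ρ + r / 2) := by
    refine Set.iUnion₂_subset fun c hc => ball_subset_ball' ?_
    rw [dist_zero_right]
    linarith [hs c hc]
  have hvol : (s.card : ENNReal) * ENNReal.ofReal ((r / 2) ^ finrank ℝ F) * μ (ball 0 1) ≤
      ENNReal.ofReal ((ρ + r / 2) ^ finrank ℝ F) * μ (ball 0 1) :=
    calc
      _ = μ (⋃ c ∈ s, ball (c : F) (r / 2)) := by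
        rw [measure_biUnion_finset hdisj fun c _ => measurableSet_ball]
        simp only [μ.addHaar_ball_of_pos _ hr2, Finset.sum_const, nsmul_eq_mul, mul_assoc]
      _ ≤ μ (ball (0 : F) (ρ + r / 2)) := measure_mono hsub
      _ = _ := by simp only [μ.addHaar_ball_of_pos _ hρ2]
  have hcard : (s.card : ENNReal) * ENNReal.ofReal ((r / 2) ^ finrank ℝ F) ≤
      ENNReal.ofReal ((ρ + r / 2) ^ finrank ℝ F) :=
    (ENNReal.mul_le_mul_iff_left (measure_ball_pos _ _ zero_lt_one).ne' measure_ball_lt_top.ne).1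
      hvol
  have hreal := ENNReal.toReal_le_of_le_ofReal (by positivity) hcard
  rw [ENNReal.toReal_mul, ENNReal.toReal_natCast, ENNReal.toReal_ofReal (by positivity),
    ← le_div_iff₀ (by positivity), ← div_pow] at hreal
  refine hreal.trans_eq ?_
  congr 1
  field_simp
  ring

/-- A bounded set contains a finite `r`-net of controlled size, namely a separated subset of
maximal cardinality. The net consists of points of `T`, so that Lipschitz bounds valid on `T` only
can be used between a point and its nearest net point. -/
theorem exists_net {r ρ : ℝ} (hr : 0 < r) (hρ : 0 ≤ ρ) (T : Set F) (hT : ∀ z ∈ T, ‖z‖ ≤ ρ) :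
    ∃ s : Finset F, (s : Set F) ⊆ T ∧ (∀ z ∈ T, ∃ c ∈ s, ‖z - c‖ < r) ∧
      (s.card : ℝ) ≤ (1 + 2 * ρ / r) ^ finrank ℝ F := by
  classical
  let N : Set ℕ := {n | ∃ s : Finset F, s.card = n ∧ (s : Set F) ⊆ T ∧
    ∀ c ∈ s, ∀ c' ∈ s, c ≠ c' → r ≤ ‖c - c'‖}
  have hne : N.Nonempty := ⟨0, ∅, by simp⟩
  have hbdd : BddAbove N := by
    refine ⟨⌊(1 + 2 * ρ / r) ^ finrank ℝ F⌋₊, ?_⟩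
    rintro n ⟨s, rfl, hsT, hsep⟩
    exact Nat.le_floor (card_le_of_separated hr hρ s (fun c hc => hT c (hsT hc)) hsep)
  obtain ⟨s, hcard, hsT, hsep⟩ := Nat.sSup_mem hne hbdd
  refine ⟨s, hsT, ?_, card_le_of_separated hr hρ s (fun c hc => hT c (hsT hc)) hsep⟩
  intro z hz
  by_contra! hfar
  have hzs : z ∉ s := fun h => by
    have := hfar z h
    simp only [sub_self, norm_zero] at this
    linarith
  have hmem : (insert z s).card ∈ N := by
    refine ⟨insert z s, rfl, ?_, ?_⟩
    · rw [Finset.coe_insert]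
      exact Set.insert_subset hz hsT
    · intro c hc c' hc' hne
      rcases Finset.mem_insert.1 hc with rfl | hcs <;>
        rcases Finset.mem_insert.1 hc' with rfl | hcs'
      · exact absurd rfl hne
      · exact hfar c' hcs'
      · rw [norm_sub_rev]
        exact hfar c hcs
      · exact hsep c hcs c' hcs' hne
  have := le_csSup hbdd hmem
  rw [Finset.card_insert_of_notMem hzs, hcard] at this
  omega

end Covering

/-! ### Tail of the supremum of a random Lipschitz function -/

section SupTail

variable {Ω : Type*} [MeasurableSpace Ω] {P : Measure Ω} [IsProbabilityMeasure P]

theorem measure_ge_le_integral_div {K : Ω → ℝ} (hK : ∀ ω, 0 ≤ K ω) (hKi : Integrable K P)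
    {A c : ℝ} (hA : ∫ ω, K ω ∂P ≤ A) (hc : 0 < c) :
    P {ω | c ≤ K ω} ≤ ENNReal.ofReal (A / c) := by
  rw [← ofReal_measureReal]
  refine ENNReal.ofReal_le_ofReal ?_
  rw [le_div_iff₀ hc, mul_comm]
  exact (mul_meas_ge_le_integral_of_nonneg (Filter.Eventually.of_forall hK) hKi c).trans hA

/-- Tail bound for the supremum over `T` of a random function with random Lipschitz constant `K`,
outside the event that the function is already large at the origin. With `q = (2p)^{1/(d+1)}` and
`v = (ρ A / t)^{1/(d+1)}`, a net of mesh `3 q ρ / v` balances the union bound over the net against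
Markov's inequality for `K`. If `3 q > v` this mesh exceeds the radius `ρ` of `T` and the origin
alone is a net; removing the event at the origin makes the bound hold in this case too, since only
the term from Markov's inequality, which is smaller than the right-hand side, is left. -/
theorem measure_exists_ge_le {F : Type*} [NormedAddCommGroup F] [NormedSpace ℝ F]
    [FiniteDimensional ℝ F] {d : ℕ} (hd : Module.finrank ℝ F = d) {T : Set F} {ρ : ℝ}
    (h0 : (0 : F) ∈ T) (hT : ∀ z ∈ T, ‖z‖ ≤ ρ) (g : Ω → F → ℝ) {K : Ω → ℝ} (hK : ∀ ω, 0 ≤ K ω)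
    (hKi : Integrable K P) {A : ℝ} (hA : ∫ ω, K ω ∂P ≤ A)
    (hlip : ∀ ω, ∀ z ∈ T, ∀ z' ∈ T, |g ω z - g ω z'| ≤ K ω * ‖z - z'‖)
    {t τ p : ℝ} (ht : 0 < t) (htτ : t ≤ τ) (hp : 0 < p)
    (htail : ∀ z ∈ T, P {ω | τ ≤ |g ω z|} ≤ ENNReal.ofReal (2 * p)) :
    P ({ω | ∃ z ∈ T, 2 * τ ≤ |g ω z|} \ {ω | 3 / 2 * τ ≤ |g ω 0|}) ≤
      ENNReal.ofReal (16 * (2 * p) ^ ((1 : ℝ) / (d + 1)) *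
        (ρ * A / t) ^ ((d : ℝ) / (d + 1))) := by
  have hτ : 0 < τ := ht.trans_le htτ
  have hρ : 0 ≤ ρ := by simpa using hT 0 h0
  have hA0 : 0 ≤ A := (integral_nonneg hK).trans hA
  have hd1 : (d : ℝ) + 1 ≠ 0 := by positivity
  set u : ℝ := ρ * A / t with hu
  have hu0 : 0 ≤ u := by positivity
  set q : ℝ := (2 * p) ^ ((1 : ℝ) / (d + 1)) with hq
  set v : ℝ := u ^ ((1 : ℝ) / (d + 1)) with hv
  have hq0 : 0 < q := by positivity
  have hv0 : 0 ≤ v := by positivity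
  have hqpow : q ^ (d + 1) = 2 * p := by
    rw [hq, ← Real.rpow_natCast, ← Real.rpow_mul (by positivity)]
    push_cast
    rw [one_div_mul_cancel hd1, Real.rpow_one]
  have hvpow : v ^ (d + 1) = u := by
    rw [hv, ← Real.rpow_natCast, ← Real.rpow_mul hu0]
    push_cast
    rw [one_div_mul_cancel hd1, Real.rpow_one]
  have hvd : u ^ ((d : ℝ) / (d + 1)) = v ^ d := by
    rw [hv, ← Real.rpow_natCast, ← Real.rpow_mul hu0]
    congr 1
    ring
  rw [hvd]
  have hvd0 : 0 ≤ q * v ^ d := by positivity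
  rcases le_or_gt (3 * q) v with hle | hgt
  · have hvpos : 0 < v := by linarith
    have hupos : 0 < u := hvpow ▸ pow_pos hvpos _
    have hρpos : 0 < ρ := by
      rcases hρ.eq_or_lt with h | h
      · simp [hu, ← h] at hupos
      · exact h
    have hratio : 0 < 3 * q / v := by positivity
    have hratio1 : 3 * q / v ≤ 1 := (div_le_one hvpos).2 hle
    set r : ℝ := 3 * q / v * ρ with hr
    have hrpos : 0 < r := by positivity
    obtain ⟨s, hsT, hcov, hcard⟩ := exists_net hrpos hρ T hT
    have hcard' : (s.card : ℝ) ≤ (v / q) ^ d := by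
      rw [hd] at hcard
      refine hcard.trans (pow_le_pow_left₀ (by positivity) ?_ d)
      rw [hr]
      have : 2 * ρ / (3 * q / v * ρ) = 2 / 3 * (v / q) := by field_simp
      rw [this]
      have : 3 ≤ v / q := (le_div_iff₀ hq0).2 hle
      linarith
    have hsub : {ω | ∃ z ∈ T, 2 * τ ≤ |g ω z|} \ {ω | 3 / 2 * τ ≤ |g ω 0|} ⊆
        (⋃ c ∈ s, {ω | τ ≤ |g ω c|}) ∪ {ω | τ / r ≤ K ω} := by
      rintro ω ⟨⟨z, hz, hgz⟩, -⟩
      obtain ⟨c, hc, hzc⟩ := hcov z hz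
      simp only [Set.mem_union, Set.mem_iUnion, Set.mem_ofPred_eq, exists_prop]
      by_contra! hcon
      have h1 := hcon.1 c hc
      have h2 := (lt_div_iff₀ hrpos).1 hcon.2
      have h3 := hlip ω z hz c (hsT hc)
      have h4 : K ω * ‖z - c‖ ≤ K ω * r := mul_le_mul_of_nonneg_left hzc.le (hK ω)
      have h5 := abs_sub_abs_le_abs_sub (g ω z) (g ω c)
      linarith
    refine (measure_mono hsub).trans ((measure_union_le _ _).trans ?_)
    have hfirst : P (⋃ c ∈ s, {ω | τ ≤ |g ω c|}) ≤ ENNReal.ofReal (q * v ^ d) := by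
      refine (measure_biUnion_finset_le _ _).trans ?_
      refine (Finset.sum_le_sum fun c hc => htail c (hsT hc)).trans ?_
      rw [Finset.sum_const, nsmul_eq_mul, ← ENNReal.ofReal_natCast,
        ← ENNReal.ofReal_mul (by positivity)]
      refine ENNReal.ofReal_le_ofReal ?_
      rw [← hqpow]
      calc (s.card : ℝ) * q ^ (d + 1) ≤ (v / q) ^ d * q ^ (d + 1) := by gcongr
        _ = q * v ^ d := by rw [div_pow, pow_succ]; field_simp
    have hsecond : P {ω | τ / r ≤ K ω} ≤ ENNReal.ofReal (3 * (q * v ^ d)) := by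
      refine (measure_ge_le_integral_div hK hKi hA (by positivity)).trans
        (ENNReal.ofReal_le_ofReal ?_)
      calc A / (τ / r) = 3 * q / v * (ρ * A / τ) := by rw [hr]; field_simp
        _ ≤ 3 * q / v * u := by rw [hu]; gcongr
        _ = 3 * (q * v ^ d) := by rw [← hvpow, pow_succ]; field_simp
    refine (add_le_add hfirst hsecond).trans ?_
    rw [← ENNReal.ofReal_add hvd0 (by positivity)]
    exact ENNReal.ofReal_le_ofReal (by linarith)
  · have hsub : {ω | ∃ z ∈ T, 2 * τ ≤ |g ω z|} \ {ω | 3 / 2 * τ ≤ |g ω 0|} ⊆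
        {ω | τ / 2 ≤ K ω * ρ} := by
      rintro ω ⟨⟨z, hz, hgz⟩, h0ω⟩
      simp only [Set.mem_ofPred_eq, not_le] at h0ω ⊢
      have h3 := hlip ω z hz 0 h0
      rw [sub_zero] at h3
      have h4 : K ω * ‖z‖ ≤ K ω * ρ := mul_le_mul_of_nonneg_left (hT z hz) (hK ω)
      have h5 := abs_sub_abs_le_abs_sub (g ω z) (g ω 0)
      linarith
    refine (measure_mono hsub).trans ?_
    have hint : ∫ ω, K ω * ρ ∂P ≤ ρ * A := by
      rw [integral_mul_const, mul_comm]
      gcongr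
    refine (measure_ge_le_integral_div (fun ω => mul_nonneg (hK ω) hρ) (hKi.mul_const ρ) hint
      (by positivity)).trans (ENNReal.ofReal_le_ofReal ?_)
    calc ρ * A / (τ / 2) = 2 * (ρ * A / τ) := by field_simp
      _ ≤ 2 * u := by rw [hu]; gcongr
      _ = 2 * (v * v ^ d) := by rw [← hvpow, pow_succ]; ring
      _ ≤ 2 * (3 * q * v ^ d) := by gcongr
      _ ≤ 16 * q * v ^ d := by nlinarith

end SupTail

/-! ### Trigonometric integrals and their derivatives -/

section TrigMoment

variable {d : ℕ} {μ : Measure (EuclideanSpace ℝ (Fin d))}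
  {c : EuclideanSpace ℝ (Fin d) → ℝ}

/-- The trigonometric integral `z ↦ ∫ c(w) cos(⟨w, z⟩ + θ) dμ(w)`. The phase `θ` makes the family
stable under differentiation, which shifts `θ` by `π / 2`. -/
def trigMoment (μ : Measure (EuclideanSpace ℝ (Fin d))) (c : EuclideanSpace ℝ (Fin d) → ℝ)
    (θ : ℝ) (z : EuclideanSpace ℝ (Fin d)) : ℝ :=
  ∫ w, c w * Real.cos (inner ℝ w z + θ) ∂μ

theorem integrable_mul_cos (hc : Integrable c μ) (θ : ℝ) (z : EuclideanSpace ℝ (Fin d)) :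
    Integrable (fun w => c w * Real.cos (inner ℝ w z + θ)) μ := by
  have hcos : Continuous fun w : EuclideanSpace ℝ (Fin d) => Real.cos (inner ℝ w z + θ) := by
    fun_prop
  refine hc.abs.mono' (hc.aestronglyMeasurable.mul hcos.aestronglyMeasurable)
    (Filter.Eventually.of_forall fun w => ?_)
  rw [norm_mul]
  exact mul_le_of_le_one_right (norm_nonneg _) (Real.abs_cos_le_one _)

theorem hasFDerivAt_trigMoment (hc : Integrable c μ) (hc1 : Integrable (fun w => |c w| * ‖w‖) μ)
    (θ : ℝ) (z : EuclideanSpace ℝ (Fin d)) :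
    HasFDerivAt (trigMoment μ c θ)
      (∫ w, (c w * Real.cos (inner ℝ w z + (θ + Real.pi / 2))) • innerSL ℝ w ∂μ) z := by
  refine hasFDerivAt_integral_of_dominated_of_fderiv_le (s := Set.univ) (𝕜 := ℝ)
    (F := fun z w => c w * Real.cos (inner ℝ w z + θ))
    (F' := fun z w => (c w * Real.cos (inner ℝ w z + (θ + Real.pi / 2))) • innerSL ℝ w)
    (bound := fun w => |c w| * ‖w‖) Filter.univ_mem ?_ (integrable_mul_cos hc θ z) ?_ ?_ hc1 ?_
  · exact Filter.Eventually.of_forall fun z => (integrable_mul_cos hc θ z).aestronglyMeasurable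
  · exact (integrable_mul_cos hc _ z).aestronglyMeasurable.smul
      (innerSL ℝ).continuous.aestronglyMeasurable
  · refine Filter.Eventually.of_forall fun w z _ => ?_
    rw [norm_smul, innerSL_apply_norm, norm_mul]
    gcongr
    exact mul_le_of_le_one_right (norm_nonneg _) (Real.abs_cos_le_one _)
  · refine Filter.Eventually.of_forall fun w z _ => ?_
    have h1 : HasFDerivAt (fun z => inner ℝ w z + θ) (innerSL ℝ w) z :=
      (innerSL ℝ w).hasFDerivAt.add_const θ
    have h2 := (h1.cos.const_mul (c w))
    convert! h2 using 1
    rw [← add_assoc, Real.cos_add_pi_div_two, smul_smul]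

theorem differentiable_trigMoment (hc : Integrable c μ)
    (hc1 : Integrable (fun w => |c w| * ‖w‖) μ) (θ : ℝ) : Differentiable ℝ (trigMoment μ c θ) :=
  fun z => (hasFDerivAt_trigMoment hc hc1 θ z).differentiableAt

theorem fderiv_trigMoment (hc : Integrable c μ) (hc1 : Integrable (fun w => |c w| * ‖w‖) μ)
    (θ : ℝ) (z h : EuclideanSpace ℝ (Fin d)) :
    fderiv ℝ (trigMoment μ c θ) z h
      = trigMoment μ (fun w => c w * inner ℝ w h) (θ + Real.pi / 2) z := by
  rw [(hasFDerivAt_trigMoment hc hc1 θ z).fderiv, ContinuousLinearMap.integral_apply]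
  · refine integral_congr_ae (Filter.Eventually.of_forall fun w => ?_)
    simp only [smul_apply, innerSL_apply_apply, smul_eq_mul]
    ring
  · refine hc1.mono' ((integrable_mul_cos hc _ z).aestronglyMeasurable.smul
      (innerSL ℝ).continuous.aestronglyMeasurable) (Filter.Eventually.of_forall fun w => ?_)
    rw [norm_smul, innerSL_apply_norm, norm_mul]
    gcongr
    exact mul_le_of_le_one_right (norm_nonneg _) (Real.abs_cos_le_one _)

theorem trigMoment_pi (z : EuclideanSpace ℝ (Fin d)) :
    trigMoment μ c Real.pi z = -trigMoment μ c 0 z := by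
  simp [trigMoment, Real.cos_add_pi, integral_neg]

theorem abs_trigMoment_le (hc : Integrable c μ) (θ : ℝ) (z : EuclideanSpace ℝ (Fin d)) :
    |trigMoment μ c θ z| ≤ ∫ w, |c w| ∂μ := by
  refine (norm_integral_le_integral_norm _).trans
    (integral_mono (integrable_mul_cos hc θ z).norm hc.abs fun w => ?_)
  simp only [norm_mul]
  exact mul_le_of_le_one_right (norm_nonneg _) (Real.abs_cos_le_one _)

theorem abs_cos_sub_cos_le (a b : ℝ) : |Real.cos a - Real.cos b| ≤ |a - b| := by
  simpa [Real.dist_eq] using Real.lipschitzWith_cos.dist_le_mul a b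

theorem abs_trigMoment_sub_le (hc : Integrable c μ) (hc1 : Integrable (fun w => |c w| * ‖w‖) μ)
    (θ : ℝ) (z z' : EuclideanSpace ℝ (Fin d)) :
    |trigMoment μ c θ z - trigMoment μ c θ z'| ≤ (∫ w, |c w| * ‖w‖ ∂μ) * ‖z - z'‖ := by
  rw [trigMoment, trigMoment, ← integral_sub (integrable_mul_cos hc θ z)
    (integrable_mul_cos hc θ z'), ← integral_mul_const]
  refine (norm_integral_le_integral_norm _).trans (integral_mono
    ((integrable_mul_cos hc θ z).sub (integrable_mul_cos hc θ z')).norm (hc1.mul_const _)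
    fun w => ?_)
  simp only [Pi.sub_apply, ← mul_sub, norm_mul, Real.norm_eq_abs, mul_assoc]
  refine mul_le_mul_of_nonneg_left ((abs_cos_sub_cos_le _ _).trans ?_) (abs_nonneg _)
  rw [add_sub_add_right_eq_sub, ← inner_sub_right]
  exact abs_real_inner_le_norm w (z - z')

end TrigMoment

/-! ### The empirical measure -/

section EmpiricalMeasure

variable {d D : ℕ}

/-- The empirical measure `D⁻¹ ∑ δ_{w_l}` of the sample `w`. -/
def empMeasure (w : Fin D → EuclideanSpace ℝ (Fin d)) : Measure (EuclideanSpace ℝ (Fin d)) :=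
  ENNReal.ofReal (1 / D) • ∑ l, Measure.dirac (w l)

theorem integrable_empMeasure (w : Fin D → EuclideanSpace ℝ (Fin d))
    (φ : EuclideanSpace ℝ (Fin d) → ℝ) : Integrable φ (empMeasure w) :=
  Integrable.smul_measure (integrable_finsetSum_measure.2 fun _ _ =>
    integrable_dirac (by simp)) ENNReal.ofReal_ne_top

theorem integral_empMeasure (w : Fin D → EuclideanSpace ℝ (Fin d))
    (φ : EuclideanSpace ℝ (Fin d) → ℝ) : ∫ a, φ a ∂(empMeasure w) = empMean φ w := by
  rw [empMeasure, integral_smul_measure, integral_finsetSum_measure fun _ _ =>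
    integrable_dirac (by simp), ENNReal.toReal_ofReal (by positivity)]
  simp [empMean]

end EmpiricalMeasure

/-! ### Second differences -/

section SecondDifference

variable {F : Type*} [NormedAddCommGroup F] [NormedSpace ℝ F]

/-- The mixed second difference of `(a, b) ↦ f (a - b)` with steps `h` at `x` and `h'` at `y`. -/
def secondDiff {F : Type*} [AddCommGroup F] (f : F → ℝ) (x h y h' : F) : ℝ :=
  f (x + h - (y + h')) - f (x + h - y) - (f (x - (y + h')) - f (x - y))

/-- Two applications of the mean value inequality bound a second difference by a bound for the mixed
second directional derivative `f₂`. The intermediate points stay in `X - X` by convexity. -/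
theorem abs_secondDiff_le {X : Set F} (hX : Convex ℝ X) {x h y h' : F} (hx : x ∈ X)
    (hxh : x + h ∈ X) (hy : y ∈ X) (hyh : y + h' ∈ X) {f f₁ f₂ : F → ℝ}
    (hf : Differentiable ℝ f) (hf₁ : Differentiable ℝ f₁) (hff₁ : ∀ z, fderiv ℝ f z h = f₁ z)
    (hff₂ : ∀ z, fderiv ℝ f₁ z h' = f₂ z) {M : ℝ} (hM : ∀ z ∈ X - X, |f₂ z| ≤ M) :
    |secondDiff f x h y h'| ≤ M := by
  have key : ∀ s ∈ Set.Ico (0 : ℝ) 1,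
      |f₁ (x + s • h - (y + h')) - f₁ (x + s • h - y)| ≤ M := by
    intro s hs
    have hd : ∀ r : ℝ, HasDerivAt (fun r : ℝ => f₁ (x + s • h - (y + r • h')))
        (-f₂ (x + s • h - (y + r • h'))) r := by
      intro r
      have h1 : HasDerivAt (fun r : ℝ => x + s • h - (y + r • h')) (-h') r := by
        simpa using (((hasDerivAt_id r).smul_const h').const_add y).const_sub (x + s • h)
      have h2 := (hf₁ (x + s • h - (y + r • h'))).hasFDerivAt.comp_hasDerivAt r h1
      rwa [map_neg, hff₂] at h2
    have := norm_image_sub_le_of_norm_deriv_le_segment_01' (C := M)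
      (fun r _ => (hd r).hasDerivWithinAt) (fun r hr => by
        rw [norm_neg]
        refine hM _ (Set.sub_mem_sub ?_ ?_)
        · simpa using hX.add_smul_sub_mem hx hxh ⟨hs.1, hs.2.le⟩
        · simpa using hX.add_smul_sub_mem hy hyh ⟨hr.1, hr.2.le⟩)
    simpa using this
  have hd : ∀ s : ℝ, HasDerivAt
      (fun s : ℝ => f (x + s • h - (y + h')) - f (x + s • h - y))
      (f₁ (x + s • h - (y + h')) - f₁ (x + s • h - y)) s := by
    intro s
    have h1 : ∀ b : F, HasDerivAt (fun s : ℝ => x + s • h - b) h s := by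
      intro b
      simpa using (((hasDerivAt_id s).smul_const h).const_add x).sub_const b
    have h2 : ∀ b : F, HasDerivAt (fun s : ℝ => f (x + s • h - b)) (f₁ (x + s • h - b)) s := by
      intro b
      have := (hf (x + s • h - b)).hasFDerivAt.comp_hasDerivAt s (h1 b)
      rwa [hff₁] at this
    exact (h2 _).sub (h2 _)
  have := norm_image_sub_le_of_norm_deriv_le_segment_01' (C := M)
      (fun s _ => (hd s).hasDerivWithinAt) key
  simpa [secondDiff] using this

end SecondDifference

/-! ### Second differences of trigonometric integrals -/

section SecondDifferenceTrig

variable {d : ℕ} {μ ν : Measure (EuclideanSpace ℝ (Fin d))} [IsFiniteMeasure μ] [IsFiniteMeasure ν]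

theorem integrable_norm_of_sq (hμ : Integrable (fun w => ‖w‖ ^ 2) μ) :
    Integrable (fun w => ‖w‖) μ := by
  refine ((integrable_const (1 : ℝ)).add hμ).mono' continuous_norm.aestronglyMeasurable
    (Filter.Eventually.of_forall fun w => ?_)
  simp only [norm_norm, Pi.add_apply]
  nlinarith [sq_nonneg (‖w‖ - 1), norm_nonneg w]

theorem integrable_inner (hμ : Integrable (fun w => ‖w‖ ^ 2) μ)
    (h : EuclideanSpace ℝ (Fin d)) : Integrable (fun w => inner ℝ w h) μ := by
  refine ((integrable_norm_of_sq hμ).mul_const ‖h‖).mono'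
    (by fun_prop : Continuous fun w => inner ℝ w h).aestronglyMeasurable
    (Filter.Eventually.of_forall fun w => abs_real_inner_le_norm w h)

omit [IsFiniteMeasure μ] in
theorem integrable_abs_inner_mul_norm (hμ : Integrable (fun w => ‖w‖ ^ 2) μ)
    (h : EuclideanSpace ℝ (Fin d)) : Integrable (fun w => |inner ℝ w h| * ‖w‖) μ := by
  refine (hμ.mul_const ‖h‖).mono'
    (by fun_prop : Continuous fun w => |inner ℝ w h| * ‖w‖).aestronglyMeasurable
    (Filter.Eventually.of_forall fun w => ?_)
  rw [norm_mul, norm_norm, Real.norm_eq_abs, abs_abs]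
  nlinarith [abs_real_inner_le_norm w h, norm_nonneg w]

omit [IsFiniteMeasure μ] in
theorem integrable_inner_mul_inner (hμ : Integrable (fun w => ‖w‖ ^ 2) μ)
    (h h' : EuclideanSpace ℝ (Fin d)) : Integrable (fun w => inner ℝ w h * inner ℝ w h') μ := by
  refine (hμ.mul_const (‖h‖ * ‖h'‖)).mono'
    (by fun_prop : Continuous fun w => inner ℝ w h * inner ℝ w h').aestronglyMeasurable
    (Filter.Eventually.of_forall fun w => ?_)
  rw [norm_mul]
  calc _ ≤ (‖w‖ * ‖h‖) * (‖w‖ * ‖h'‖) :=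
        mul_le_mul (abs_real_inner_le_norm w h) (abs_real_inner_le_norm w h') (abs_nonneg _)
          (by positivity)
    _ = _ := by ring

theorem differentiable_trigMoment_one (hμ : Integrable (fun w => ‖w‖ ^ 2) μ) :
    Differentiable ℝ (trigMoment μ (fun _ => 1) 0) :=
  differentiable_trigMoment (integrable_const _) (by simpa using integrable_norm_of_sq hμ) 0

theorem fderiv_trigMoment_one (hμ : Integrable (fun w => ‖w‖ ^ 2) μ)
    (z h : EuclideanSpace ℝ (Fin d)) : fderiv ℝ (trigMoment μ (fun _ => 1) 0) z h
      = trigMoment μ (fun w => inner ℝ w h) (Real.pi / 2) z := by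
  simpa using fderiv_trigMoment (integrable_const (1 : ℝ))
    (by simpa using integrable_norm_of_sq hμ) 0 z h

theorem differentiable_trigMoment_inner (hμ : Integrable (fun w => ‖w‖ ^ 2) μ)
    (h : EuclideanSpace ℝ (Fin d)) (θ : ℝ) :
    Differentiable ℝ (trigMoment μ (fun w => inner ℝ w h) θ) :=
  differentiable_trigMoment (integrable_inner hμ h) (integrable_abs_inner_mul_norm hμ h) _

theorem fderiv_trigMoment_inner (hμ : Integrable (fun w => ‖w‖ ^ 2) μ)
    (z h h' : EuclideanSpace ℝ (Fin d)) :
    fderiv ℝ (trigMoment μ (fun w => inner ℝ w h) (Real.pi / 2)) z h'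
      = -trigMoment μ (fun w => inner ℝ w h * inner ℝ w h') 0 z := by
  rw [fderiv_trigMoment (integrable_inner hμ h) (integrable_abs_inner_mul_norm hμ h), add_halves,
    trigMoment_pi]

omit [IsFiniteMeasure μ] in
theorem abs_trigMoment_inner_mul_inner_le (hμ : Integrable (fun w => ‖w‖ ^ 2) μ)
    (h h' z : EuclideanSpace ℝ (Fin d)) :
    |trigMoment μ (fun w => inner ℝ w h * inner ℝ w h') 0 z|
      ≤ (∫ w, ‖w‖ ^ 2 ∂μ) * (‖h‖ * ‖h'‖) := by
  refine (abs_trigMoment_le (integrable_inner_mul_inner hμ h h') 0 z).trans ?_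
  rw [← integral_mul_const]
  refine integral_mono (integrable_inner_mul_inner hμ h h').abs (hμ.mul_const _) fun w => ?_
  simp only [abs_mul]
  calc _ ≤ (‖w‖ * ‖h‖) * (‖w‖ * ‖h'‖) :=
        mul_le_mul (abs_real_inner_le_norm w h) (abs_real_inner_le_norm w h') (abs_nonneg _)
          (by positivity)
    _ = _ := by ring

theorem abs_secondDiff_trigMoment_le (hμ : Integrable (fun w => ‖w‖ ^ 2) μ)
    (x h y h' : EuclideanSpace ℝ (Fin d)) :
    |secondDiff (trigMoment μ (fun _ => 1) 0) x h y h'| ≤ (∫ w, ‖w‖ ^ 2 ∂μ) * (‖h‖ * ‖h'‖) :=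
  abs_secondDiff_le convex_univ trivial trivial trivial trivial
    (differentiable_trigMoment_one hμ) (differentiable_trigMoment_inner hμ h _)
    (fun z => fderiv_trigMoment_one hμ z h) (fun z => fderiv_trigMoment_inner hμ z h h')
    fun z _ => by rw [abs_neg]; exact abs_trigMoment_inner_mul_inner_le hμ h h' z

omit [IsFiniteMeasure μ] in
theorem integrable_apply_mul_apply (hμ : Integrable (fun w => ‖w‖ ^ 2) μ) (i j : Fin d) :
    Integrable (fun w : EuclideanSpace ℝ (Fin d) => w i * w j) μ := by
  simpa [EuclideanSpace.inner_single_right] using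
    integrable_inner_mul_inner hμ (EuclideanSpace.single i 1) (EuclideanSpace.single j 1)

omit [IsFiniteMeasure μ] in
theorem trigMoment_inner_mul_inner (hμ : Integrable (fun w => ‖w‖ ^ 2) μ)
    (h h' z : EuclideanSpace ℝ (Fin d)) :
    trigMoment μ (fun w => inner ℝ w h * inner ℝ w h') 0 z
      = ∑ i, ∑ j, h i * h' j * trigMoment μ (fun w => w i * w j) 0 z := by
  simp only [trigMoment, ← integral_const_mul]
  have hint := fun i j => (integrable_mul_cos (integrable_apply_mul_apply hμ i j) 0 z).const_mul
    (h i * h' j)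
  simp_rw [← integral_finsetSum _ fun j _ => hint _ j]
  rw [← integral_finsetSum _ fun i _ => integrable_finsetSum _ fun j _ => hint i j]
  refine integral_congr_ae (Filter.Eventually.of_forall fun w => ?_)
  simp only [PiLp.inner_apply, RCLike.inner_apply, conj_trivial]
  rw [Finset.sum_mul_sum, Finset.sum_mul]
  refine Finset.sum_congr rfl fun i _ => ?_
  rw [Finset.sum_mul]
  exact Finset.sum_congr rfl fun j _ => by ring

theorem sum_abs_le_sqrt_mul_norm (h : EuclideanSpace ℝ (Fin d)) :
    ∑ i, |h i| ≤ Real.sqrt d * ‖h‖ := by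
  rw [EuclideanSpace.norm_eq, ← Real.sqrt_mul (by positivity)]
  refine Real.le_sqrt_of_sq_le ?_
  simpa using sq_sum_le_card_mul_sum_sq (s := Finset.univ) (f := fun i => |h i|)

/-- An entrywise bound `δ` for the difference of the Hessians on `X - X` gives a bound for second
differences. The dimension appears because the `ℓ¹` norm of each of the two steps is at most
`√d` times its Euclidean norm. -/
theorem abs_secondDiff_trigMoment_sub_le (hμ : Integrable (fun w => ‖w‖ ^ 2) μ)
    (hν : Integrable (fun w => ‖w‖ ^ 2) ν) {X : Set (EuclideanSpace ℝ (Fin d))}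
    (hX : Convex ℝ X) {x h y h' : EuclideanSpace ℝ (Fin d)} (hx : x ∈ X) (hxh : x + h ∈ X)
    (hy : y ∈ X) (hyh : y + h' ∈ X) {δ : ℝ}
    (hδ : ∀ i j, ∀ z ∈ X - X, |trigMoment μ (fun w => w i * w j) 0 z
      - trigMoment ν (fun w => w i * w j) 0 z| ≤ δ) :
    |secondDiff (trigMoment μ (fun _ => 1) 0) x h y h'
      - secondDiff (trigMoment ν (fun _ => 1) 0) x h y h'| ≤ d * δ * (‖h‖ * ‖h'‖) := by
  have hsub : secondDiff (trigMoment μ (fun _ => 1) 0) x h y h'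
      - secondDiff (trigMoment ν (fun _ => 1) 0) x h y h'
      = secondDiff (trigMoment μ (fun _ => 1) 0 - trigMoment ν (fun _ => 1) 0) x h y h' := by
    simp only [secondDiff, Pi.sub_apply]
    ring
  rw [hsub]
  refine abs_secondDiff_le hX hx hxh hy hyh
    (f₁ := trigMoment μ (fun w => inner ℝ w h) (Real.pi / 2)
      - trigMoment ν (fun w => inner ℝ w h) (Real.pi / 2))
    (f₂ := fun z => -trigMoment μ (fun w => inner ℝ w h * inner ℝ w h') 0 z
      - -trigMoment ν (fun w => inner ℝ w h * inner ℝ w h') 0 z)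
    ((differentiable_trigMoment_one hμ).sub (differentiable_trigMoment_one hν))
    ((differentiable_trigMoment_inner hμ h _).sub (differentiable_trigMoment_inner hν h _))
    (fun z => ?_) (fun z => ?_) fun z hz => ?_
  · rw [fderiv_sub (differentiable_trigMoment_one hμ z) (differentiable_trigMoment_one hν z),
      sub_apply, fderiv_trigMoment_one hμ, fderiv_trigMoment_one hν,
      Pi.sub_apply]
  · rw [fderiv_sub (differentiable_trigMoment_inner hμ h _ z)
      (differentiable_trigMoment_inner hν h _ z), sub_apply,
      fderiv_trigMoment_inner hμ, fderiv_trigMoment_inner hν]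
  · rw [neg_sub_neg, abs_sub_comm, trigMoment_inner_mul_inner hμ, trigMoment_inner_mul_inner hν]
    simp only [← Finset.sum_sub_distrib, ← mul_sub]
    calc _ ≤ ∑ i, ∑ j, |h i * h' j * (trigMoment μ (fun w => w i * w j) 0 z
          - trigMoment ν (fun w => w i * w j) 0 z)| :=
          (Finset.abs_sum_le_sum_abs _ _).trans
            (Finset.sum_le_sum fun i _ => Finset.abs_sum_le_sum_abs _ _)
      _ ≤ ∑ i, ∑ j, |h i| * |h' j| * δ := by
          refine Finset.sum_le_sum fun i _ => Finset.sum_le_sum fun j _ => ?_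
          rw [abs_mul, abs_mul]
          exact mul_le_mul_of_nonneg_left (hδ i j z hz) (by positivity)
      _ = (∑ i, |h i|) * (∑ j, |h' j|) * δ := by
          simp only [← Finset.sum_mul, Finset.sum_mul_sum]
      _ ≤ d * δ * (‖h‖ * ‖h'‖) := by
          rcases Nat.eq_zero_or_pos d with rfl | hd
          · simp
          have hδ0 : 0 ≤ δ := (abs_nonneg _).trans (hδ ⟨0, hd⟩ ⟨0, hd⟩ z hz)
          calc _ ≤ (Real.sqrt d * ‖h‖) * (Real.sqrt d * ‖h'‖) * δ := by
                gcongr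
                · exact sum_abs_le_sqrt_mul_norm h
                · exact sum_abs_le_sqrt_mul_norm h'
            _ = (Real.sqrt d * Real.sqrt d) * δ * (‖h‖ * ‖h'‖) := by ring
            _ = _ := by rw [Real.mul_self_sqrt (by positivity)]

end SecondDifferenceTrig

/-! ### Comparison of two signature kernels -/

section SignatureComparison

/-- Telescoping estimate for a difference of products, with relative error `κ` in each factor. -/
theorem abs_prod_sub_prod_le {ι : Type*} (s : Finset ι) (a b c : ι → ℝ) {α κ : ℝ}
    (ha : ∀ p, |a p| ≤ α * c p) (hb : ∀ p, |b p| ≤ α * c p)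
    (hab : ∀ p, |a p - b p| ≤ α * κ * c p) :
    |∏ p ∈ s, a p - ∏ p ∈ s, b p| ≤ s.card * α ^ s.card * κ * ∏ p ∈ s, c p := by
  classical
  induction s using Finset.induction_on with
  | empty => simp
  | insert i s hi ih =>
    rw [Finset.prod_insert hi, Finset.prod_insert hi, Finset.prod_insert hi,
      Finset.card_insert_of_notMem hi]
    have hprod : |∏ p ∈ s, a p| ≤ α ^ s.card * ∏ p ∈ s, c p := by
      rw [Finset.abs_prod, ← Finset.prod_const, ← Finset.prod_mul_distrib]
      exact Finset.prod_le_prod (fun p _ => abs_nonneg _) fun p _ => ha p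
    have h1 : |(a i - b i) * ∏ p ∈ s, a p| ≤ α * κ * c i * (α ^ s.card * ∏ p ∈ s, c p) := by
      rw [abs_mul]
      exact mul_le_mul (hab i) hprod (abs_nonneg _) ((abs_nonneg _).trans (hab i))
    have h2 : |b i * (∏ p ∈ s, a p - ∏ p ∈ s, b p)|
        ≤ α * c i * (s.card * α ^ s.card * κ * ∏ p ∈ s, c p) := by
      rw [abs_mul]
      exact mul_le_mul (hb i) ih (abs_nonneg _) ((abs_nonneg _).trans (hb i))
    calc |a i * ∏ p ∈ s, a p - b i * ∏ p ∈ s, b p|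
        = |(a i - b i) * ∏ p ∈ s, a p + b i * (∏ p ∈ s, a p - ∏ p ∈ s, b p)| := by
          congr 1; ring
      _ ≤ _ := (abs_add_le _ _).trans (add_le_add h1 h2)
      _ = _ := by push_cast; ring

theorem sum_simplexIndex_prod_le {m n : ℕ} {u : Fin n → ℝ} (hu : ∀ i, 0 ≤ u i) :
    ∑ i ∈ simplexIndex m n, ∏ p, u (i p) ≤ (∑ i, u i) ^ m := by
  have : (∑ i, u i) ^ m = ∑ i : Fin m → Fin n, ∏ p, u (i p) := by
    rw [← Fin.prod_const, Finset.prod_univ_sum, Fintype.piFinset_univ]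
  rw [this]
  exact Finset.sum_le_sum_of_subset_of_nonneg (Finset.filter_subset _ _)
    fun i _ _ => Finset.prod_nonneg fun p _ => hu _

variable {E : Type*} [NormedAddCommGroup E] {X : Set E}

/-- If the inner products of increments under both feature maps are at most `α` times the product of
the step lengths, and differ by at most `α κ` times it, then the level-`m` signature kernels of
sequences of 1-variation at most `V` differ by at most `m (V² α)^m κ`. -/
theorem abs_sigInner_sub_sigInner_le {G G' : Type*} [NormedAddCommGroup G] [InnerProductSpace ℝ G]
    [NormedAddCommGroup G'] [InnerProductSpace ℝ G'] {m : ℕ} (φ : Fin m → E → G)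
    (ψ : Fin m → E → G') (x y : Sequence X) {α κ V : ℝ} (hα : 0 ≤ α) (hκ : 0 ≤ κ)
    (hx : oneVar x ≤ V) (hy : oneVar y ≤ V)
    (hφ : ∀ p i j, |inner ℝ (delta (φ p) x i) (delta (φ p) y j)|
      ≤ α * (‖delta id x i‖ * ‖delta id y j‖))
    (hψ : ∀ p i j, |inner ℝ (delta (ψ p) x i) (delta (ψ p) y j)|
      ≤ α * (‖delta id x i‖ * ‖delta id y j‖))
    (hφψ : ∀ p i j, |inner ℝ (delta (φ p) x i) (delta (φ p) y j)
      - inner ℝ (delta (ψ p) x i) (delta (ψ p) y j)|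
      ≤ α * κ * (‖delta id x i‖ * ‖delta id y j‖)) :
    |sigInner φ x y - sigInner ψ x y| ≤ m * (V ^ 2 * α) ^ m * κ := by
  rw [sigInner_eq_sum, sigInner_eq_sum]
  simp only [← Finset.sum_sub_distrib]
  have hx0 : 0 ≤ oneVar x := Finset.sum_nonneg fun i _ => norm_nonneg _
  have hy0 : 0 ≤ oneVar y := Finset.sum_nonneg fun i _ => norm_nonneg _
  calc _ ≤ ∑ i ∈ simplexIndex m x.1, ∑ j ∈ simplexIndex m y.1,
        |∏ p, inner ℝ (delta (φ p) x (i p)) (delta (φ p) y (j p))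
          - ∏ p, inner ℝ (delta (ψ p) x (i p)) (delta (ψ p) y (j p))| :=
        (Finset.abs_sum_le_sum_abs _ _).trans
          (Finset.sum_le_sum fun i _ => Finset.abs_sum_le_sum_abs _ _)
    _ ≤ ∑ i ∈ simplexIndex m x.1, ∑ j ∈ simplexIndex m y.1, m * α ^ m * κ *
        ((∏ p, ‖delta id x (i p)‖) * ∏ p, ‖delta id y (j p)‖) := by
        refine Finset.sum_le_sum fun i _ => Finset.sum_le_sum fun j _ => ?_
        rw [← Finset.prod_mul_distrib]
        simpa using abs_prod_sub_prod_le Finset.univ _ _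
          (fun p => ‖delta id x (i p)‖ * ‖delta id y (j p)‖) (fun p => hφ p (i p) (j p))
          (fun p => hψ p (i p) (j p)) (fun p => hφψ p (i p) (j p))
    _ = m * α ^ m * κ * ((∑ i ∈ simplexIndex m x.1, ∏ p, ‖delta id x (i p)‖) *
        ∑ j ∈ simplexIndex m y.1, ∏ p, ‖delta id y (j p)‖) := by
        rw [Finset.sum_mul_sum]
        simp only [Finset.mul_sum]
    _ ≤ m * α ^ m * κ * (V ^ m * V ^ m) := by
        have h1 : ∑ i ∈ simplexIndex m x.1, ∏ p, ‖delta id x (i p)‖ ≤ V ^ m :=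
          (sum_simplexIndex_prod_le fun i => norm_nonneg _).trans (pow_le_pow_left₀ hx0 hx m)
        have h2 : ∑ j ∈ simplexIndex m y.1, ∏ p, ‖delta id y (j p)‖ ≤ V ^ m :=
          (sum_simplexIndex_prod_le fun i => norm_nonneg _).trans (pow_le_pow_left₀ hy0 hy m)
        have h3 : 0 ≤ V ^ m := pow_nonneg (hx0.trans hx) m
        have h4 : 0 ≤ ∑ j ∈ simplexIndex m y.1, ∏ p, ‖delta id y (j p)‖ :=
          Finset.sum_nonneg fun j _ => Finset.prod_nonneg fun p _ => norm_nonneg _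
        gcongr
    _ = _ := by ring

theorem inner_delta_eq_secondDiff {G : Type*} [NormedAddCommGroup G] [InnerProductSpace ℝ G]
    {φ : E → G} {f : E → ℝ} (hf : ∀ a b, inner ℝ (φ a) (φ b) = f (a - b)) (x y : Sequence X)
    (i : Fin x.1) (j : Fin y.1) :
    inner ℝ (delta φ x i) (delta φ y j)
      = secondDiff f (x.2 i.castSucc) (delta id x i) (y.2 j.castSucc) (delta id y j) := by
  simp only [delta, secondDiff, inner_sub_left, inner_sub_right, hf, id, add_sub_cancel]
  ring

end SignatureComparison

/-! ### Inner products of the two feature maps -/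

section FeatureMaps

variable {d D : ℕ}

theorem inner_rffMap (w : Fin D → EuclideanSpace ℝ (Fin d)) (x y : EuclideanSpace ℝ (Fin d)) :
    inner ℝ (rffMap w x) (rffMap w y) = trigMoment (empMeasure w) (fun _ => 1) 0 (x - y) := by
  rw [trigMoment, integral_empMeasure, empMean, PiLp.inner_apply, Fintype.sum_sum_type,
    ← Finset.sum_add_distrib, Finset.mul_sum]
  refine Finset.sum_congr rfl fun l _ => ?_
  have hD : 1 / Real.sqrt D * (1 / Real.sqrt D) = 1 / (D : ℝ) := by
    rw [div_mul_div_comm, one_mul, Real.mul_self_sqrt (by positivity)]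
  simp only [rffMap, Sum.elim_inl, Sum.elim_inr, RCLike.inner_apply, conj_trivial, one_mul,
    add_zero, inner_sub_right, Real.cos_sub, ← hD]
  ring

variable {Λ : Measure (EuclideanSpace ℝ (Fin d))} [IsProbabilityMeasure Λ]
  {k : EuclideanSpace ℝ (Fin d) → EuclideanSpace ℝ (Fin d) → ℝ}

theorem IsSpectralMeasure.eq_trigMoment (hΛ : IsSpectralMeasure k Λ)
    (x y : EuclideanSpace ℝ (Fin d)) : k x y = trigMoment Λ (fun _ => 1) 0 (x - y) := by
  have h := congrArg Complex.re (hΛ x y)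
  rw [Complex.ofReal_re] at h
  have hint : Integrable
      (fun w : EuclideanSpace ℝ (Fin d) => Complex.exp (Complex.I * (inner ℝ w (x - y) : ℝ)))
        Λ := by
    refine (integrable_const (1 : ℝ)).mono'
      (by fun_prop : Continuous fun w : EuclideanSpace ℝ (Fin d) =>
        Complex.exp (Complex.I * (inner ℝ w (x - y) : ℝ))).aestronglyMeasurable
      (Filter.Eventually.of_forall fun w => ?_)
    rw [mul_comm, Complex.norm_exp_ofReal_mul_I]
  rw [h, trigMoment, ← RCLike.re_eq_complex_re, ← integral_re hint]
  refine integral_congr_ae (Filter.Eventually.of_forall fun w => ?_)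
  simp only [RCLike.re_eq_complex_re, one_mul, add_zero]
  rw [mul_comm, Complex.exp_ofReal_mul_I_re]

theorem inner_kerFun_eq_trigMoment {H : Type*} [NormedAddCommGroup H] [InnerProductSpace ℝ H]
    [CompleteSpace H] [RKHS ℝ H (EuclideanSpace ℝ (Fin d)) ℝ]
    (hH : ∀ x y, RKHS.kernel H x y (1 : ℝ) = k x y) (hΛ : IsSpectralMeasure k Λ)
    (x y : EuclideanSpace ℝ (Fin d)) :
    inner ℝ (RKHS.kerFun H x (1 : ℝ)) (RKHS.kerFun H y (1 : ℝ))
      = trigMoment Λ (fun _ => 1) 0 (x - y) := by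
  rw [RKHS.kerFun_inner, RKHS.kerFun_apply, hH, hΛ.eq_trigMoment]
  simp

end FeatureMaps

/-! ### Signature kernel error in terms of the Hessian deviation -/

section DeterministicBound

variable {d D m : ℕ} {Λ : Measure (EuclideanSpace ℝ (Fin d))} [IsProbabilityMeasure Λ]
  {k : EuclideanSpace ℝ (Fin d) → EuclideanSpace ℝ (Fin d) → ℝ}

/-- The `(i, j)` entry at `z` of the Hessian of the kernel minus the Hessian of its random Fourier
approximation, `D⁻¹ ∑ w_{l,i} w_{l,j} cos ⟨w_l, z⟩ - E[w_i w_j cos ⟨w, z⟩]`. -/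
def hessDev (Λ : Measure (EuclideanSpace ℝ (Fin d))) (w : Fin D → EuclideanSpace ℝ (Fin d))
    (i j : Fin d) (z : EuclideanSpace ℝ (Fin d)) : ℝ :=
  trigMoment (empMeasure w) (fun v => v i * v j) 0 z - trigMoment Λ (fun v => v i * v j) 0 z

instance (w : Fin D → EuclideanSpace ℝ (Fin d)) : IsFiniteMeasure (empMeasure w) :=
  Measure.smul_finite _ ENNReal.ofReal_ne_top

theorem abs_sigKernel_sub_rfsfKernel_le {H : Type*} [NormedAddCommGroup H]
    [InnerProductSpace ℝ H] [CompleteSpace H] [RKHS ℝ H (EuclideanSpace ℝ (Fin d)) ℝ]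
    (hH : ∀ x y, RKHS.kernel H x y (1 : ℝ) = k x y) (hΛ : IsSpectralMeasure k Λ)
    (hsq : Integrable (fun w => ‖w‖ ^ 2) Λ) {X : Set (EuclideanSpace ℝ (Fin d))}
    (hX : Convex ℝ X) (W : Fin m → Fin D → EuclideanSpace ℝ (Fin d)) {α κ V : ℝ}
    (hα : 0 ≤ α) (hκ : 0 ≤ κ) (hσ : sigmaSq Λ ≤ α)
    (hW : ∀ p, empMean (fun w => ‖w‖ ^ 2) (W p) ≤ α)
    (hdev : ∀ p i j, ∀ z ∈ X - X, d * |hessDev Λ (W p) i j z| ≤ α * κ)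
    {x y : Sequence X} (hx : oneVar x ≤ V) (hy : oneVar y ≤ V) :
    |sigKernel H m x y - rfsfKernel W x y| ≤ m * (V ^ 2 * α) ^ m * κ := by
  have hk := inner_kerFun_eq_trigMoment hH hΛ
  rcases Nat.eq_zero_or_pos d with rfl | hd
  · refine abs_sigInner_sub_sigInner_le _ _ x y hα hκ hx hy (fun p i j => ?_) (fun p i j => ?_)
      (fun p i j => ?_) <;>
    · rw [Subsingleton.elim (delta id x i) 0]
      simp [inner_delta_eq_secondDiff hk, inner_delta_eq_secondDiff (inner_rffMap (W p)),
        Subsingleton.elim (delta id x i) 0, secondDiff]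
  have hd' : (0 : ℝ) < d := by exact_mod_cast hd
  refine abs_sigInner_sub_sigInner_le _ _ x y hα hκ hx hy (fun p i j => ?_) (fun p i j => ?_)
    fun p i j => ?_
  · rw [inner_delta_eq_secondDiff hk]
    exact (abs_secondDiff_trigMoment_le hsq _ _ _ _).trans (by gcongr; exact hσ)
  · rw [inner_delta_eq_secondDiff (inner_rffMap (W p))]
    refine (abs_secondDiff_trigMoment_le (integrable_empMeasure _ _) _ _ _ _).trans ?_
    rw [integral_empMeasure]
    gcongr
    exact hW p
  · rw [inner_delta_eq_secondDiff hk, inner_delta_eq_secondDiff (inner_rffMap (W p)), abs_sub_comm]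
    refine (abs_secondDiff_trigMoment_sub_le (δ := α * κ / d) (integrable_empMeasure _ _) hsq hX
      (Subtype.prop _) ?_ (Subtype.prop _) ?_ fun i' j' z hz => ?_).trans_eq ?_
    · simp [delta]
    · simp [delta]
    · rw [le_div_iff₀ hd', mul_comm]
      exact hdev p i' j' z hz
    · field_simp

/-- A strict bound for the Hessian deviation on the compact set `X - X` gives a strict bound for the
supremum of the kernel error, because the deviation is continuous and attains its maximum. -/
theorem uniformError_lt {H : Type*} [NormedAddCommGroup H]
    [InnerProductSpace ℝ H] [CompleteSpace H] [RKHS ℝ H (EuclideanSpace ℝ (Fin d)) ℝ]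
    (hd : 1 ≤ d) (hm : 1 ≤ m)
    (hH : ∀ x y, RKHS.kernel H x y (1 : ℝ) = k x y) (hΛ : IsSpectralMeasure k Λ)
    (hsq : Integrable (fun w => ‖w‖ ^ 2) Λ) {X : Set (EuclideanSpace ℝ (Fin d))}
    (hXc : IsCompact X) (hX : Convex ℝ X) (W : Fin m → Fin D → EuclideanSpace ℝ (Fin d))
    {α κ V ε : ℝ} (hα : 0 < α) (hV : 0 < V) (hσ : sigmaSq Λ ≤ α)
    (hW : ∀ p, empMean (fun w => ‖w‖ ^ 2) (W p) ≤ α)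
    (hdev : ∀ p i j, ∀ z ∈ X - X, d * |hessDev Λ (W p) i j z| < α * κ)
    (hcont : ∀ p i j, Continuous (hessDev Λ (W p) i j))
    (hε : m * (V ^ 2 * α) ^ m * κ ≤ ε) (hε0 : 0 < ε) :
    uniformError H X V W < ENNReal.ofReal ε := by
  rcases X.eq_empty_or_nonempty with rfl | hne
  · have : uniformError H ∅ V W = 0 := by
      simp only [uniformError, ENNReal.iSup_eq_zero]
      exact fun x => (x.2 0).2.elim
    rw [this]
    exact ENNReal.ofReal_pos.2 hε0
  have hne' : (X - X).Nonempty := hne.sub hne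
  have hcpt : IsCompact (X - X) := by
    rw [sub_eq_add_neg]
    exact hXc.add hXc.neg
  have hmax : ∀ q : Fin m × Fin d × Fin d, ∃ z ∈ X - X, ∀ z' ∈ X - X,
      |hessDev Λ (W q.1) q.2.1 q.2.2 z'| ≤ |hessDev Λ (W q.1) q.2.1 q.2.2 z| := fun q =>
    hcpt.exists_isMaxOn hne' (hcont _ _ _).abs.continuousOn
  choose zmax hzmem hzmax using hmax
  have : Nonempty (Fin m × Fin d × Fin d) := ⟨⟨0, hm⟩, ⟨0, hd⟩, ⟨0, hd⟩⟩
  obtain ⟨q₀, hq₀⟩ := Finite.exists_max fun q : Fin m × Fin d × Fin d =>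
    |hessDev Λ (W q.1) q.2.1 q.2.2 (zmax q)|
  set δ := d * |hessDev Λ (W q₀.1) q₀.2.1 q₀.2.2 (zmax q₀)| with hδ
  have hδlt : δ < α * κ := hdev _ _ _ _ (hzmem q₀)
  have hδ0 : 0 ≤ δ := by positivity
  have hbound : ∀ x y : Sequence X, oneVar x ≤ V → oneVar y ≤ V →
      |sigKernel H m x y - rfsfKernel W x y| ≤ m * (V ^ 2 * α) ^ m * (δ / α) := by
    intro x y hx hy
    refine abs_sigKernel_sub_rfsfKernel_le hH hΛ hsq hX W hα.le (by positivity) hσ hW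
      (fun p i j z hz => ?_) hx hy
    rw [mul_div_cancel₀ _ hα.ne', hδ]
    exact mul_le_mul_of_nonneg_left ((hzmax (p, i, j) z hz).trans (hq₀ (p, i, j))) (by positivity)
  have hm' : (0 : ℝ) < m := by exact_mod_cast hm
  have hlt : m * (V ^ 2 * α) ^ m * (δ / α) < ε := by
    refine lt_of_lt_of_le ?_ hε
    have : δ / α < κ := by rwa [div_lt_iff₀ hα, mul_comm]
    gcongr
  refine lt_of_le_of_lt ?_ ((ENNReal.ofReal_lt_ofReal_iff hε0).2 hlt)
  exact iSup_le fun x => iSup_le fun y => iSup_le fun hx => iSup_le fun hy =>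
    ENNReal.ofReal_le_ofReal (hbound x y hx hy)

end DeterministicBound

/-! ### Moments of the spectral measure and smoothness of the kernel -/

section Moments

variable {d : ℕ} {Λ : Measure (EuclideanSpace ℝ (Fin d))} [IsProbabilityMeasure Λ] {S R : ℝ}
  {k : EuclideanSpace ℝ (Fin d) → EuclideanSpace ℝ (Fin d) → ℝ}

omit [IsProbabilityMeasure Λ] in
/-- The entries `w_i w_j cos ⟨w, z⟩` inherit the moment condition of the coordinates through
`|w_i w_j|^n ≤ (w_i^{2n} + w_j^{2n}) / 2`. -/
theorem BernsteinCondition.bernsteinMoments (hB : BernsteinCondition Λ S R) (i j : Fin d)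
    (z : EuclideanSpace ℝ (Fin d)) :
    BernsteinMoments (fun w : EuclideanSpace ℝ (Fin d) => w i * w j * Real.cos (inner ℝ w z + 0))
      Λ S R := by
  intro n hn
  have hle : ∀ w : EuclideanSpace ℝ (Fin d), |w i * w j * Real.cos (inner ℝ w z + 0)| ^ n
      ≤ (w i ^ (2 * n) + w j ^ (2 * n)) / 2 := by
    intro w
    calc |w i * w j * Real.cos (inner ℝ w z + 0)| ^ n ≤ |w i * w j| ^ n := by
          rw [abs_mul (w i * w j)]
          exact pow_le_pow_left₀ (by positivity)
            (mul_le_of_le_one_right (abs_nonneg _) (Real.abs_cos_le_one _)) n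
      _ = |w i| ^ n * |w j| ^ n := by rw [abs_mul, mul_pow]
      _ ≤ (w i ^ (2 * n) + w j ^ (2 * n)) / 2 := by
          have h : ∀ a : ℝ, a ^ (2 * n) = (|a| ^ n) ^ 2 := fun a => by
            rw [pow_mul, ← sq_abs, ← pow_mul, ← pow_mul, mul_comm]
          rw [h, h]
          nlinarith [sq_nonneg (|w i| ^ n - |w j| ^ n)]
  have hint := (((hB i n hn).1.add (hB j n hn).1).div_const 2)
  have hint' : Integrable (fun w : EuclideanSpace ℝ (Fin d) =>
      |w i * w j * Real.cos (inner ℝ w z + 0)| ^ n) Λ := by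
    refine hint.mono' (by fun_prop : Continuous fun w : EuclideanSpace ℝ (Fin d) =>
      |w i * w j * Real.cos (inner ℝ w z + 0)| ^ n).aestronglyMeasurable
      (Filter.Eventually.of_forall fun w => ?_)
    rw [Real.norm_of_nonneg (by positivity)]
    exact hle w
  refine ⟨hint', (integral_mono hint' hint hle).trans ?_⟩
  simp only [Pi.add_apply]
  rw [integral_div, integral_add (hB i n hn).1 (hB j n hn).1]
  linarith [(hB i n hn).2, (hB j n hn).2]

omit [IsProbabilityMeasure Λ] in
theorem BernsteinCondition.integrable_norm_pow_four (hB : BernsteinCondition Λ S R) :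
    Integrable (fun w => ‖w‖ ^ 4) Λ := by
  have hint : Integrable (fun w : EuclideanSpace ℝ (Fin d) => (d : ℝ) * ∑ i, w i ^ 4) Λ :=
    (integrable_finsetSum _ fun i _ => (hB i 2 le_rfl).1).const_mul _
  refine hint.mono' (by fun_prop : Continuous fun w : EuclideanSpace ℝ (Fin d) =>
    ‖w‖ ^ 4).aestronglyMeasurable (Filter.Eventually.of_forall fun w => ?_)
  rw [Real.norm_of_nonneg (by positivity)]
  have h := sq_sum_le_card_mul_sum_sq (s := Finset.univ) (f := fun i => w i ^ 2)
  rw [← EuclideanSpace.real_norm_sq_eq] at h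
  simpa [← pow_mul] using h

theorem BernsteinCondition.integrable_norm_pow (hB : BernsteinCondition Λ S R) {n : ℕ}
    (hn : n ≤ 4) : Integrable (fun w => ‖w‖ ^ n) Λ := by
  refine ((integrable_const (1 : ℝ)).add hB.integrable_norm_pow_four).mono'
    (by fun_prop : Continuous fun w : EuclideanSpace ℝ (Fin d) => ‖w‖ ^ n).aestronglyMeasurable
    (Filter.Eventually.of_forall fun w => ?_)
  rw [Real.norm_of_nonneg (by positivity), Pi.add_apply]
  rcases le_total ‖w‖ 1 with h | h
  · have := pow_le_one₀ (n := n) (norm_nonneg w) h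
    have : 0 ≤ ‖w‖ ^ 4 := by positivity
    linarith
  · have := pow_le_pow_right₀ h hn
    linarith

theorem BernsteinCondition.integrable_abs_mul_norm (hB : BernsteinCondition Λ S R) (i j : Fin d) :
    Integrable (fun w : EuclideanSpace ℝ (Fin d) => |w i * w j| * ‖w‖) Λ := by
  refine (hB.integrable_norm_pow (n := 3) (by norm_num)).mono'
    (by fun_prop : Continuous fun w : EuclideanSpace ℝ (Fin d) =>
      |w i * w j| * ‖w‖).aestronglyMeasurable (Filter.Eventually.of_forall fun w => ?_)
  rw [Real.norm_of_nonneg (by positivity), abs_mul]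
  calc |w i| * |w j| * ‖w‖ ≤ ‖w‖ * ‖w‖ * ‖w‖ := by
        gcongr
        · exact PiLp.norm_apply_le w i
        · exact PiLp.norm_apply_le w j
    _ = ‖w‖ ^ 3 := by ring

theorem BernsteinCondition.contDiff (hB : BernsteinCondition Λ S R) (hΛ : IsSpectralMeasure k Λ) :
    ContDiff ℝ 3 (fun z => k z 0) := by
  have hmem : MemLp (id : EuclideanSpace ℝ (Fin d) → _) ((3 : ℕ) : ENNReal) Λ := by
    rw [← integrable_norm_rpow_iff continuous_id.aestronglyMeasurable (by norm_num) (by simp)]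
    simpa using hB.integrable_norm_pow (n := 3) (by norm_num)
  have hk : (fun z => k z 0) = fun z => Complex.reCLM (charFun Λ z) := by
    funext z
    have h := hΛ z 0
    simp only [sub_zero, mul_comm Complex.I] at h
    rw [charFun_apply, ← h]
    simp
  rw [hk]
  exact Complex.reCLM.contDiff.comp (contDiff_charFun hmem)

theorem partialDeriv_partialDeriv (hB : BernsteinCondition Λ S R) (hΛ : IsSpectralMeasure k Λ)
    (i j : Fin d) : partialDeriv i (partialDeriv j (fun u => k u 0))
      = fun z => -trigMoment Λ (fun w => w i * w j) 0 z := by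
  have hsq := hB.integrable_norm_pow (n := 2) (by norm_num)
  have hk : (fun u => k u 0) = trigMoment Λ (fun _ => 1) 0 := by
    funext u
    rw [hΛ.eq_trigMoment, sub_zero]
  have h1 : partialDeriv j (fun u => k u 0)
      = trigMoment Λ (fun w => inner ℝ w (EuclideanSpace.single j (1 : ℝ))) (Real.pi / 2) := by
    funext z
    rw [hk]
    exact fderiv_trigMoment_one hsq z _
  funext z
  rw [h1]
  refine (fderiv_trigMoment_inner hsq z _ _).trans ?_
  simp [EuclideanSpace.inner_single_right, mul_comm]

theorem gradNorm_eq (hB : BernsteinCondition Λ S R) (hΛ : IsSpectralMeasure k Λ) (i j : Fin d)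
    (z : EuclideanSpace ℝ (Fin d)) :
    gradNorm k i j z = ‖fderiv ℝ (trigMoment Λ (fun w => w i * w j) 0) z‖ := by
  rw [gradNorm, partialDeriv_partialDeriv hB hΛ, gradient, LinearIsometryEquiv.norm_map,
    fderiv_fun_neg, norm_neg]

theorem bddAbove_gradNorm (hB : BernsteinCondition Λ S R) (hΛ : IsSpectralMeasure k Λ)
    (i j : Fin d) (X : Set (EuclideanSpace ℝ (Fin d))) :
    BddAbove (gradNorm k i j '' X) := by
  have hsq := hB.integrable_norm_pow (n := 2) (by norm_num)
  refine ⟨momentE Λ i j, ?_⟩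
  rintro _ ⟨z, -, rfl⟩
  rw [gradNorm_eq hB hΛ]
  exact norm_fderiv_le_of_lip' ℝ (integral_nonneg fun w => by positivity)
    (Filter.Eventually.of_forall fun z' => abs_trigMoment_sub_le
      (integrable_apply_mul_apply hsq i j) (hB.integrable_abs_mul_norm i j) 0 z' z)

theorem abs_trigMoment_sub_le_derivD (hB : BernsteinCondition Λ S R)
    (hΛ : IsSpectralMeasure k Λ) (i j : Fin d) {X : Set (EuclideanSpace ℝ (Fin d))}
    (hX : Convex ℝ X) {z z' : EuclideanSpace ℝ (Fin d)} (hz : z ∈ X - X) (hz' : z' ∈ X - X) :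
    |trigMoment Λ (fun w => w i * w j) 0 z - trigMoment Λ (fun w => w i * w j) 0 z'|
      ≤ derivD k X i j * ‖z - z'‖ := by
  have hsq := hB.integrable_norm_pow (n := 2) (by norm_num)
  refine (hX.sub hX).norm_image_sub_le_of_norm_fderiv_le (𝕜 := ℝ)
    (fun v _ => differentiable_trigMoment (integrable_apply_mul_apply hsq i j)
      (hB.integrable_abs_mul_norm i j) 0 v) (fun v hv => ?_) hz' hz
  rw [← gradNorm_eq hB hΛ]
  exact le_csSup (bddAbove_gradNorm hB hΛ i j _) ⟨v, hv, rfl⟩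

theorem derivD_nonneg (X : Set (EuclideanSpace ℝ (Fin d))) (i j : Fin d) : 0 ≤ derivD k X i j :=
  Real.sSup_nonneg (by rintro _ ⟨z, -, rfl⟩; exact norm_nonneg _)

omit [IsProbabilityMeasure Λ] in
theorem momentE_nonneg (i j : Fin d) : 0 ≤ momentE Λ i j :=
  integral_nonneg fun w => by positivity

end Moments

/-! ### Tail bound for one entry of the Hessian deviation -/

section Tail

variable {d D : ℕ} {Λ : Measure (EuclideanSpace ℝ (Fin d))} [IsProbabilityMeasure Λ] {S R : ℝ}
  {k : EuclideanSpace ℝ (Fin d) → EuclideanSpace ℝ (Fin d) → ℝ}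
  {Ω : Type*} [MeasurableSpace Ω] {P : Measure Ω} [IsProbabilityMeasure P]
  {W : Fin D → Ω → EuclideanSpace ℝ (Fin d)}

omit [IsProbabilityMeasure Λ] in
theorem hessDev_eq_empMean_sub (w : Fin D → EuclideanSpace ℝ (Fin d)) (i j : Fin d)
    (z : EuclideanSpace ℝ (Fin d)) :
    hessDev Λ w i j z = empMean (fun v => v i * v j * Real.cos (inner ℝ v z + 0)) w
      - ∫ v, v i * v j * Real.cos (inner ℝ v z + 0) ∂Λ := by
  rw [hessDev, trigMoment, trigMoment, integral_empMeasure]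

theorem continuous_hessDev (hB : BernsteinCondition Λ S R)
    (w : Fin D → EuclideanSpace ℝ (Fin d)) (i j : Fin d) : Continuous (hessDev Λ w i j) :=
  (differentiable_trigMoment (integrable_empMeasure w _)
    (integrable_empMeasure w _) 0).continuous.sub
  (differentiable_trigMoment
    (integrable_apply_mul_apply (hB.integrable_norm_pow (n := 2) (by norm_num)) i j)
    (hB.integrable_abs_mul_norm i j) 0).continuous

theorem abs_hessDev_sub_le (hB : BernsteinCondition Λ S R) (hΛ : IsSpectralMeasure k Λ)
    (w : Fin D → EuclideanSpace ℝ (Fin d)) (i j : Fin d) {X : Set (EuclideanSpace ℝ (Fin d))}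
    (hX : Convex ℝ X) {z z' : EuclideanSpace ℝ (Fin d)} (hz : z ∈ X - X) (hz' : z' ∈ X - X) :
    |hessDev Λ w i j z - hessDev Λ w i j z'|
      ≤ (derivD k X i j + empMean (fun v => |v i * v j| * ‖v‖) w) * ‖z - z'‖ := by
  have h1 := abs_trigMoment_sub_le_derivD hB hΛ i j hX hz hz'
  have h2 := abs_trigMoment_sub_le (integrable_empMeasure w fun v => v i * v j)
    (integrable_empMeasure w _) 0 z z'
  rw [integral_empMeasure] at h2
  have h3 : hessDev Λ w i j z - hessDev Λ w i j z'
      = (trigMoment (empMeasure w) (fun v => v i * v j) 0 z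
          - trigMoment (empMeasure w) (fun v => v i * v j) 0 z')
        - (trigMoment Λ (fun v => v i * v j) 0 z - trigMoment Λ (fun v => v i * v j) 0 z') := by
    simp only [hessDev]; ring
  rw [h3, add_mul]
  exact (abs_sub _ _).trans (by linarith)

omit [IsProbabilityMeasure Λ] [IsProbabilityMeasure P] in
theorem integrable_empMean (hW : ∀ l, Measurable (W l)) (hlaw : ∀ l, P.map (W l) = Λ)
    {φ : EuclideanSpace ℝ (Fin d) → ℝ} (hφ : Integrable φ Λ) :
    Integrable (fun ω => empMean φ (fun l => W l ω)) P := by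
  refine Integrable.const_mul (integrable_finsetSum _ fun l _ => ?_) _
  rw [← hlaw l] at hφ
  exact hφ.comp_measurable (hW l)

omit [IsProbabilityMeasure Λ] [IsProbabilityMeasure P] in
theorem integral_empMean (hD : 1 ≤ D) (hW : ∀ l, Measurable (W l))
    (hlaw : ∀ l, P.map (W l) = Λ) {φ : EuclideanSpace ℝ (Fin d) → ℝ} (hφ : Integrable φ Λ) :
    ∫ ω, empMean φ (fun l => W l ω) ∂P = ∫ v, φ v ∂Λ := by
  have hl : ∀ l, ∫ ω, φ (W l ω) ∂P = ∫ v, φ v ∂Λ := fun l => by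
    rw [← integral_map (hW l).aemeasurable (by rw [hlaw l]; exact hφ.aestronglyMeasurable), hlaw l]
  have hi : ∀ l, Integrable (fun ω => φ (W l ω)) P := fun l => by
    rw [← hlaw l] at hφ
    exact hφ.comp_measurable (hW l)
  have hD' : (D : ℝ) ≠ 0 := by positivity
  simp only [empMean]
  rw [integral_const_mul, integral_finsetSum _ fun l _ => hi l]
  simp only [hl, Finset.sum_const, Finset.card_univ, Fintype.card_fin, nsmul_eq_mul]
  field_simp

variable (k Λ) in
/-- The bound of `measure_exists_ge_le` for the `(i, j)` entry of the Hessian deviation, whose mean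
Lipschitz constant on `X - X` is at most `D_{i,j} + E_{i,j}`. -/
def netBound (X : Set (EuclideanSpace ℝ (Fin d))) (p t : ℝ) (i j : Fin d) : ℝ :=
  16 * (2 * p) ^ ((1 : ℝ) / (d + 1)) *
    (Metric.diam X * (derivD k X i j + momentE Λ i j) / t) ^ ((d : ℝ) / (d + 1))

theorem measure_hessDev_ge_le (hB : BernsteinCondition Λ S R) (hS : 0 < S) (hR : 0 < R)
    (hΛ : IsSpectralMeasure k Λ) {X : Set (EuclideanSpace ℝ (Fin d))} (hXc : IsCompact X)
    (hX : Convex ℝ X) (hD : 1 ≤ D) (hW : ∀ l, Measurable (W l)) (hind : iIndepFun W P)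
    (hlaw : ∀ l, P.map (W l) = Λ) (i j : Fin d) {t τ p : ℝ} (ht : 0 < t) (htτ : t ≤ τ)
    (hp : Real.exp (-(D * (τ ^ 2 / (2 * (S ^ 2 + R * τ))))) ≤ p) :
    P ({ω | ∃ z ∈ X - X, 2 * τ ≤ |hessDev Λ (fun l => W l ω) i j z|} \
        {ω | 3 / 2 * τ ≤ |hessDev Λ (fun l => W l ω) i j 0|})
      ≤ ENNReal.ofReal (netBound Λ k X p t i j) := by
  rcases X.eq_empty_or_nonempty with rfl | ⟨x₀, hx₀⟩
  · simp
  have hE := hB.integrable_abs_mul_norm i j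
  refine measure_exists_ge_le (by simp) (T := X - X) ⟨x₀, hx₀, x₀, hx₀, sub_self x₀⟩ ?_
    (fun ω z => hessDev Λ (fun l => W l ω) i j z)
    (K := fun ω => derivD k X i j + empMean (fun v => |v i * v j| * ‖v‖) (fun l => W l ω))
    (fun ω => ?_) ?_ ?_ (fun ω z hz z' hz' => abs_hessDev_sub_le hB hΛ _ i j hX hz hz') ht htτ
    ((Real.exp_pos _).trans_le hp) fun z _ => ?_
  · rintro _ ⟨x, hx, y, hy, rfl⟩
    simpa [dist_eq_norm] using Metric.dist_le_diam_of_mem hXc.isBounded hx hy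
  · exact add_nonneg (derivD_nonneg X i j)
      (mul_nonneg (by positivity) (Finset.sum_nonneg fun l _ => by positivity))
  · exact (integrable_const _).add (integrable_empMean hW hlaw hE)
  · rw [integral_add (integrable_const _) (integrable_empMean hW hlaw hE),
      integral_empMean hD hW hlaw hE]
    simp [momentE]
  · simp only [hessDev_eq_empMean_sub]
    refine ((hB.bernsteinMoments i j z).measure_abs_empMean_ge_le
      (by fun_prop : Continuous fun w : EuclideanSpace ℝ (Fin d) =>
        w i * w j * Real.cos (inner ℝ w z + 0)).measurable hS hR hD hW hind hlaw
      (ht.trans_le htτ)).trans (ENNReal.ofReal_le_ofReal ?_)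
    gcongr

end Tail

/-! ### Tail bound for the uniform error -/

section Concentration

variable {d D m : ℕ} {Λ : Measure (EuclideanSpace ℝ (Fin d))} [IsProbabilityMeasure Λ] {S R : ℝ}
  {k : EuclideanSpace ℝ (Fin d) → EuclideanSpace ℝ (Fin d) → ℝ}
  {Ω : Type*} [MeasurableSpace Ω] {P : Measure Ω} [IsProbabilityMeasure P]

omit [IsProbabilityMeasure Λ] in
/-- The empirical second moment is governed by the diagonal of the Hessian deviation at the origin,
so that no separate concentration estimate for it is needed. -/
theorem empMean_norm_sq (hsq : Integrable (fun w => ‖w‖ ^ 2) Λ)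
    (w : Fin D → EuclideanSpace ℝ (Fin d)) :
    empMean (fun v => ‖v‖ ^ 2) w = sigmaSq Λ + ∑ i, hessDev Λ w i i 0 := by
  have h1 : empMean (fun v => ‖v‖ ^ 2) w = ∑ i, empMean (fun v => v i * v i) w := by
    simp only [empMean, EuclideanSpace.real_norm_sq_eq, ← pow_two]
    rw [Finset.sum_comm, Finset.mul_sum]
  have h2 : sigmaSq Λ = ∑ i, ∫ v, v i * v i ∂Λ := by
    rw [← integral_finsetSum _ fun i _ => integrable_apply_mul_apply hsq i i]
    simp only [sigmaSq, EuclideanSpace.real_norm_sq_eq, ← pow_two]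
  simp only [hessDev_eq_empMean_sub, inner_zero_right, add_zero, Real.cos_zero, mul_one,
    Finset.sum_sub_distrib]
  rw [h1, h2]
  ring

omit [IsProbabilityMeasure Λ] in
theorem constBeta_eq (V : ℝ) : constBeta Λ m V
    = m * (V ^ 2 * (2 * max (sigmaSq Λ) d * max (lipConst Λ ^ 2) 1)) ^ m := by
  rw [constBeta]
  congr 2
  ring

variable {H : Type*} [NormedAddCommGroup H] [InnerProductSpace ℝ H] [CompleteSpace H]
  [RKHS ℝ H (EuclideanSpace ℝ (Fin d)) ℝ] {X : Set (EuclideanSpace ℝ (Fin d))}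

/-- The case `α = 2 max(σ², d) max(L², 1) θ` of `uniformError_lt`. This `α`
dominates both the second moment `σ²` and the empirical second moment. -/
theorem uniformError_lt_of_hessDev_lt (hd : 1 ≤ d) (hm : 1 ≤ m)
    (hH : ∀ x y, RKHS.kernel H x y (1 : ℝ) = k x y) (hB : BernsteinCondition Λ S R)
    (hΛ : IsSpectralMeasure k Λ) (hXc : IsCompact X) (hX : Convex ℝ X)
    (w : Fin m → Fin D → EuclideanSpace ℝ (Fin d)) {τ θ κ V ε : ℝ} (hθ : 1 ≤ θ)
    (hdev : ∀ p i j, ∀ z ∈ X - X, |hessDev Λ (w p) i j z| < 2 * τ)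
    (hdiag : ∀ p i, hessDev Λ (w p) i i 0 ≤ θ)
    (hκ : d * τ ≤ max (sigmaSq Λ) d * max (lipConst Λ ^ 2) 1 * θ * κ)
    (hV : 0 < V) (hε0 : 0 < ε) (hε : constBeta Λ m V * θ ^ m * κ ≤ ε) :
    uniformError H X V w < ENNReal.ofReal ε := by
  have hd' : (1 : ℝ) ≤ d := by exact_mod_cast hd
  have hsq := hB.integrable_norm_pow (n := 2) (by norm_num)
  set s := max (sigmaSq Λ) d with hs
  set l := max (lipConst Λ ^ 2) 1 with hl
  have hsd : (d : ℝ) ≤ s := le_max_right _ _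
  have hsσ : sigmaSq Λ ≤ s := le_max_left _ _
  have hl1 : 1 ≤ l := le_max_right _ _
  have hs0 : 0 < s := by linarith
  have hsθ : s ≤ s * θ := le_mul_of_one_le_right hs0.le hθ
  have hdθ : d * θ ≤ s * θ := by gcongr
  have h2sθ : 2 * s * θ ≤ 2 * s * l * θ := by
    have : 2 * s ≤ 2 * s * l := le_mul_of_one_le_right (by positivity) hl1
    gcongr
  refine uniformError_lt hd hm hH hΛ hsq hXc hX w (α := 2 * s * l * θ) (κ := κ) (by positivity) hV
    (by linarith) (fun p => ?_) (fun p i j z hz => ?_) (fun p i j => continuous_hessDev hB _ i j)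
    ?_ hε0
  · rw [empMean_norm_sq hsq]
    have : ∑ i, hessDev Λ (w p) i i 0 ≤ d * θ := by
      simpa using Finset.sum_le_sum fun i (_ : i ∈ Finset.univ) => hdiag p i
    linarith
  · have : d * |hessDev Λ (w p) i j z| < d * (2 * τ) := by
      have := hdev p i j z hz
      gcongr
    linarith
  · refine le_trans (le_of_eq ?_) hε
    rw [constBeta_eq]
    ring

theorem ofReal_sum_sum {ι ι' : Type*} [Fintype ι] [Fintype ι'] {f : ι → ι' → ℝ}
    (hf : ∀ i j, 0 ≤ f i j) :
    ENNReal.ofReal (∑ i, ∑ j, f i j) = ∑ i, ∑ j, ENNReal.ofReal (f i j) := by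
  rw [ENNReal.ofReal_sum_of_nonneg fun i _ => Finset.sum_nonneg fun j _ => hf i j]
  exact Finset.sum_congr rfl fun i _ => ENNReal.ofReal_sum_of_nonneg fun j _ => hf i j

omit [IsProbabilityMeasure Λ] in
theorem netBound_nonneg {p t : ℝ} (hp : 0 ≤ p) (ht : 0 ≤ t) (i j : Fin d) :
    0 ≤ netBound Λ k X p t i j := by
  have := derivD_nonneg (k := k) X i j
  have := momentE_nonneg (Λ := Λ) i j
  have : 0 ≤ Metric.diam X := Metric.diam_nonneg
  rw [netBound]
  positivity

/-- Union bound over the `m` feature maps and the `d²` entries of the Hessian deviation.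
The parameter `t` is the accuracy required of the entries, and `θ ≥ 1` the factor by which the
empirical second moments may exceed their natural size. -/
theorem measure_uniformError_ge_le (hd : 1 ≤ d) (hm : 1 ≤ m) (hD : 1 ≤ D)
    (hH : ∀ x y, RKHS.kernel H x y (1 : ℝ) = k x y) (hS : 0 < S) (hR : 0 < R)
    (hB : BernsteinCondition Λ S R)
    (hΛ : IsSpectralMeasure k Λ) (hXc : IsCompact X) (hX : Convex ℝ X)
    {W : Fin m → Fin D → Ω → EuclideanSpace ℝ (Fin d)} (hW : ∀ p j, Measurable (W p j))
    (hind : iIndepFun (fun q : Fin m × Fin D => W q.1 q.2) P) (hlaw : ∀ p j, P.map (W p j) = Λ)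
    {t θ p V ε : ℝ} (ht : 0 < t) (htθ : t ≤ θ) (hθ : 1 ≤ θ) (hV : 0 < V) (hε0 : 0 < ε)
    (hp : Real.exp (-(D * (t ^ 2 / (2 * (S ^ 2 + R * t))))) ≤ p)
    (hε : constBeta Λ m V * θ ^ m * (t / θ) ≤ ε) :
    P {ω | ENNReal.ofReal ε ≤ uniformError H X V (fun p j => W p j ω)} ≤
      ENNReal.ofReal (m * (∑ i, ∑ j, netBound Λ k X p t i j + 2 * d ^ 2 * p)) := by
  have hp0 : 0 < p := (Real.exp_pos _).trans_le hp
  have hindq : ∀ q, iIndepFun (W q) P := fun q =>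
    hind.precomp (g := fun l => (q, l)) fun a b hab => (Prod.ext_iff.1 hab).2
  -- The second event is the one removed in `measure_hessDev_ge_le`, enlarged to the threshold `t`:
  -- its complement also controls the empirical second moments.
  set bad : Fin m → Fin d → Fin d → Set Ω := fun q i j =>
    ({ω | ∃ z ∈ X - X, 2 * t ≤ |hessDev Λ (fun l => W q l ω) i j z|} \
        {ω | 3 / 2 * t ≤ |hessDev Λ (fun l => W q l ω) i j 0|}) ∪
      {ω | t ≤ |hessDev Λ (fun l => W q l ω) i j 0|} with hbad
  have hbadP : ∀ q i j, P (bad q i j) ≤ ENNReal.ofReal (netBound Λ k X p t i j + 2 * p) := by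
    intro q i j
    rw [ENNReal.ofReal_add (netBound_nonneg hp0.le ht.le i j) (by positivity)]
    refine (measure_union_le _ _).trans (add_le_add
      (measure_hessDev_ge_le hB hS hR hΛ hXc hX hD (hW q) (hindq q) (hlaw q) i j ht le_rfl hp) ?_)
    simp only [hessDev_eq_empMean_sub]
    refine ((hB.bernsteinMoments i j 0).measure_abs_empMean_ge_le
      (by fun_prop : Continuous fun w : EuclideanSpace ℝ (Fin d) =>
        w i * w j * Real.cos (inner ℝ w 0 + 0)).measurable hS hR hD (hW q) (hindq q) (hlaw q)
      ht).trans (ENNReal.ofReal_le_ofReal ?_)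
    gcongr
  have hsub : {ω | ENNReal.ofReal ε ≤ uniformError H X V (fun p j => W p j ω)}
      ⊆ ⋃ q, ⋃ i, ⋃ j, bad q i j := by
    intro ω hω
    by_contra hcon
    simp only [hbad, Set.mem_iUnion, Set.mem_union, Set.mem_sdiff, Set.mem_ofPred_eq] at hcon
    push Not at hcon
    refine absurd hω (not_le.2 (uniformError_lt_of_hessDev_lt hd hm hH hB hΛ hXc hX _ (τ := t)
      (κ := t / θ) hθ (fun q i j z hz => ?_) (fun q i => ?_) ?_ hV hε0 hε))
    · by_contra! hge
      have h1 := (hcon q i j).1 ⟨z, hz, hge⟩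
      have h2 := (hcon q i j).2
      linarith
    · exact (le_abs_self _).trans ((hcon q i i).2.le.trans htθ)
    · have hsd : (d : ℝ) ≤ max (sigmaSq Λ) d * max (lipConst Λ ^ 2) 1 :=
        (le_max_right _ _).trans (le_mul_of_one_le_right
          ((Nat.cast_nonneg d).trans (le_max_right _ _)) (le_max_right _ _))
      rw [mul_assoc, mul_div_cancel₀ _ (by positivity : θ ≠ 0)]
      gcongr
  calc P {ω | ENNReal.ofReal ε ≤ uniformError H X V (fun p j => W p j ω)}
      ≤ P (⋃ q, ⋃ i, ⋃ j, bad q i j) := measure_mono hsub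
    _ ≤ ∑ q, ∑ i, ∑ j, P (bad q i j) :=
        (measure_iUnion_fintype_le _ _).trans (Finset.sum_le_sum fun q _ =>
          (measure_iUnion_fintype_le _ _).trans (Finset.sum_le_sum fun i _ =>
            measure_iUnion_fintype_le _ _))
    _ ≤ ∑ _q : Fin m, ∑ i, ∑ j, ENNReal.ofReal (netBound Λ k X p t i j + 2 * p) :=
        Finset.sum_le_sum fun q _ => Finset.sum_le_sum fun i _ => Finset.sum_le_sum fun j _ =>
          hbadP q i j
    _ = _ := by
        rw [← ofReal_sum_sum fun i j => add_nonneg (netBound_nonneg hp0.le ht.le i j)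
          (by positivity), Finset.sum_const, Finset.card_univ, Fintype.card_fin, nsmul_eq_mul,
          ← ENNReal.ofReal_natCast, ← ENNReal.ofReal_mul (by positivity)]
        congr 2
        simp only [Finset.sum_add_distrib, Finset.sum_const, Finset.card_univ, Fintype.card_fin,
          nsmul_eq_mul]
        ring

/-- For `d = m = 1` and a large deviation `θ ≥ 1`, the two-sided tail at the origin is replaced by a
one-sided one, which saves the factor `2` in front of `p`. -/
theorem measure_uniformError_ge_le_of_dim_one {Λ : Measure (EuclideanSpace ℝ (Fin 1))}
    [IsProbabilityMeasure Λ] {k : EuclideanSpace ℝ (Fin 1) → EuclideanSpace ℝ (Fin 1) → ℝ}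
    [RKHS ℝ H (EuclideanSpace ℝ (Fin 1)) ℝ] {X : Set (EuclideanSpace ℝ (Fin 1))} (hD : 1 ≤ D)
    (hH : ∀ x y, RKHS.kernel H x y (1 : ℝ) = k x y) (hS : 0 < S) (hR : 0 < R)
    (hB : BernsteinCondition Λ S R)
    (hΛ : IsSpectralMeasure k Λ) (hXc : IsCompact X) (hX : Convex ℝ X)
    {W : Fin 1 → Fin D → Ω → EuclideanSpace ℝ (Fin 1)} (hW : ∀ p j, Measurable (W p j))
    (hind : iIndepFun (fun q : Fin 1 × Fin D => W q.1 q.2) P) (hlaw : ∀ p j, P.map (W p j) = Λ)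
    {θ p V ε : ℝ} (hθ : 1 ≤ θ) (hV : 0 < V) (hε0 : 0 < ε)
    (hp : ∀ τ, θ ≤ τ → Real.exp (-(D * (τ ^ 2 / (2 * (S ^ 2 + R * τ))))) ≤ p)
    (hε : constBeta Λ 1 V * θ ≤ ε) :
    P {ω | ENNReal.ofReal ε ≤ uniformError H X V (fun p j => W p j ω)} ≤
      ENNReal.ofReal (∑ i, ∑ j, netBound Λ k X p θ i j + p) := by
  have hp0 : 0 < p := (Real.exp_pos _).trans_le (hp θ le_rfl)
  have hθ0 : 0 < θ := by linarith
  have hsq := hB.integrable_norm_pow (n := 2) (by norm_num)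
  have hind0 : iIndepFun (W 0) P :=
    hind.precomp (g := fun l => ((0 : Fin 1), l)) fun a b hab => (Prod.ext_iff.1 hab).2
  set s := max (sigmaSq Λ) 1 with hs
  have hs1 : 1 ≤ s := le_max_right _ _
  have hsσ : sigmaSq Λ ≤ s := le_max_left _ _
  have hθs : θ ≤ s * θ := le_mul_of_one_le_left hθ0.le hs1
  have hssθ : s ≤ s * θ := le_mul_of_one_le_right (by positivity) hθ
  have hsub : {ω | ENNReal.ofReal ε ≤ uniformError H X V (fun p j => W p j ω)}
      ⊆ ({ω | ∃ z ∈ X - X, 2 * (s * θ) ≤ |hessDev Λ (fun l => W 0 l ω) 0 0 z|} \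
          {ω | 3 / 2 * (s * θ) ≤ |hessDev Λ (fun l => W 0 l ω) 0 0 0|}) ∪
        {ω | θ ≤ hessDev Λ (fun l => W 0 l ω) 0 0 0} := by
    intro ω hω
    by_contra hcon
    simp only [Set.mem_union, Set.mem_sdiff, Set.mem_ofPred_eq] at hcon
    push Not at hcon
    -- The empirical second moment is nonnegative, which excludes a large negative deviation.
    have hlow : -sigmaSq Λ ≤ hessDev Λ (fun l => W 0 l ω) 0 0 0 := by
      have h1 := empMean_norm_sq hsq (fun l => W 0 l ω)
      have h2 : 0 ≤ empMean (fun v => ‖v‖ ^ 2) (fun l => W 0 l ω) :=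
        mul_nonneg (by positivity) (Finset.sum_nonneg fun l _ => by positivity)
      rw [Fin.sum_univ_one] at h1
      linarith
    refine absurd hω (not_le.2 (uniformError_lt_of_hessDev_lt le_rfl le_rfl hH hB hΛ hXc hX _
      (τ := s * θ) (κ := 1) hθ (fun q i j z hz => ?_) (fun q i => ?_) ?_ hV hε0
      (by simpa using hε)))
    · rw [Subsingleton.elim q 0, Subsingleton.elim i 0, Subsingleton.elim j 0]
      by_contra! hge
      have h1 := hcon.1 ⟨z, hz, hge⟩
      rcases le_abs.1 h1 with h | h <;> linarith [hcon.2]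
    · rw [Subsingleton.elim q 0, Subsingleton.elim i 0]
      exact hcon.2.le
    · rw [Nat.cast_one, one_mul, mul_one]
      have : s ≤ s * max (lipConst Λ ^ 2) 1 :=
        le_mul_of_one_le_right (by positivity) (le_max_right _ _)
      gcongr
  rw [ENNReal.ofReal_add (Finset.sum_nonneg fun i _ => Finset.sum_nonneg fun j _ =>
    netBound_nonneg hp0.le hθ0.le i j) hp0.le]
  refine (measure_mono hsub).trans ((measure_union_le _ _).trans (add_le_add ?_ ?_))
  · simpa using measure_hessDev_ge_le hB hS hR hΛ hXc hX hD (hW 0) hind0 (hlaw 0) 0 0 hθ0 hθs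
      (hp _ hθs)
  · simp only [hessDev_eq_empMean_sub]
    exact ((hB.bernsteinMoments 0 0 0).measure_empMean_ge_le
      (by fun_prop : Continuous fun w : EuclideanSpace ℝ (Fin 1) =>
        w 0 * w 0 * Real.cos (inner ℝ w 0 + 0)).measurable hS hR hD (hW 0) hind0 (hlaw 0)
      hθ0).trans (ENNReal.ofReal_le_ofReal (hp θ le_rfl))

end Concentration

/-! ### The constants of the bound -/

section Constants

variable {d : ℕ}

theorem sum_netBound_eq (Λ : Measure (EuclideanSpace ℝ (Fin d)))
    (k : EuclideanSpace ℝ (Fin d) → EuclideanSpace ℝ (Fin d) → ℝ)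
    (X : Set (EuclideanSpace ℝ (Fin d))) {x t : ℝ} (hx : 0 ≤ x) (ht : 0 < t) :
    ∑ i, ∑ j, netBound Λ k X (x ^ (d + 1)) t i j
      = constC k Λ X * (1 / t) ^ ((d : ℝ) / (d + 1)) * x := by
  have hroot : (2 * x ^ (d + 1)) ^ ((1 : ℝ) / (d + 1)) = 2 ^ ((1 : ℝ) / (d + 1)) * x := by
    rw [Real.mul_rpow (by norm_num) (by positivity)]
    congr 1
    have := Real.pow_rpow_inv_natCast hx (Nat.succ_ne_zero d)
    rw [one_div]
    exact_mod_cast this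
  have hterm : ∀ i j, netBound Λ k X (x ^ (d + 1)) t i j
      = 2 ^ ((1 : ℝ) / (d + 1)) * 16 * Metric.diam X ^ ((d : ℝ) / (d + 1)) *
        (derivD k X i j + momentE Λ i j) ^ ((d : ℝ) / (d + 1)) *
          (1 / t) ^ ((d : ℝ) / (d + 1)) * x := by
    intro i j
    have hA : 0 ≤ derivD k X i j + momentE Λ i j :=
      add_nonneg (derivD_nonneg X i j) (momentE_nonneg i j)
    rw [netBound, hroot, div_eq_mul_one_div (Metric.diam X * _) t,
      Real.mul_rpow (mul_nonneg Metric.diam_nonneg hA)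
      (by positivity), Real.mul_rpow Metric.diam_nonneg hA]
    ring
  simp only [hterm, constC, Finset.mul_sum, Finset.sum_mul]

/-- The union bound at the origin costs `2 d² x^{d+1}`, where `x` is the exponential factor in the
final bound. This is absorbed by the additive constant `d` as soon as the bound is nontrivial. -/
theorem two_mul_sq_mul_pow_le {m : ℕ} (hd : 1 ≤ d) (hm : 1 ≤ m) (hdm : ¬(d = 1 ∧ m = 1)) {x : ℝ}
    (hx : 0 ≤ x) (hle : m * d * x ≤ 1) : 2 * (d : ℝ) ^ 2 * x ^ (d + 1) ≤ d * x := by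
  have hd' : (1 : ℝ) ≤ d := by exact_mod_cast hd
  have hm' : (1 : ℝ) ≤ m := by exact_mod_cast hm
  have hdx : d * x ≤ 1 := by
    refine le_trans ?_ hle
    rw [mul_assoc]
    exact le_mul_of_one_le_left (by positivity) hm'
  suffices h : 2 * (d * x ^ d) ≤ 1 by
    calc 2 * (d : ℝ) ^ 2 * x ^ (d + 1) = 2 * (d * x ^ d) * (d * x) := by ring
      _ ≤ 1 * (d * x) := by gcongr
      _ = d * x := one_mul _
  rcases hd.eq_or_lt with rfl | hd2
  · have hm2 : (2 : ℝ) ≤ m := by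
      have : 2 ≤ m := by omega
      exact_mod_cast this
    simp only [Nat.cast_one, mul_one, one_mul, pow_one] at hle ⊢
    exact le_trans (by gcongr) hle
  · obtain ⟨e, rfl⟩ : ∃ e, d = e + 2 := ⟨d - 2, by omega⟩
    have h2 : (2 : ℝ) ≤ (e + 2 : ℕ) := by push_cast; linarith [Nat.cast_nonneg (α := ℝ) e]
    have h2x : 2 * x ≤ 1 := le_trans (by gcongr) hdx
    have hxe : x ^ (e + 1) ≤ x := by
      rw [pow_succ]
      exact mul_le_of_le_one_left hx (pow_le_one₀ hx (by linarith))
    calc 2 * (((e + 2 : ℕ) : ℝ) * x ^ (e + 2)) = 2 * x ^ (e + 1) * (((e + 2 : ℕ) : ℝ) * x) := by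
          ring
      _ ≤ 2 * x ^ (e + 1) * 1 := by gcongr
      _ ≤ 1 := by linarith

theorem constC_nonneg (k : EuclideanSpace ℝ (Fin d) → EuclideanSpace ℝ (Fin d) → ℝ)
    (Λ : Measure (EuclideanSpace ℝ (Fin d))) (X : Set (EuclideanSpace ℝ (Fin d))) :
    0 ≤ constC k Λ X := by
  have hA : ∀ i j, 0 ≤ derivD k X i j + momentE Λ i j := fun i j =>
    add_nonneg (derivD_nonneg X i j) (momentE_nonneg i j)
  have : 0 ≤ Metric.diam X := Metric.diam_nonneg
  refine mul_nonneg (by positivity) (Finset.sum_nonneg fun i _ => Finset.sum_nonneg fun j _ => ?_)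
  exact Real.rpow_nonneg (hA i j) _

theorem constBeta_pos {Λ : Measure (EuclideanSpace ℝ (Fin d))} {m : ℕ} (hd : 1 ≤ d) (hm : 1 ≤ m)
    {V : ℝ} (hV : 0 < V) : 0 < constBeta Λ m V := by
  have h1 : 0 < max (lipConst Λ ^ 2) 1 := lt_max_of_lt_right one_pos
  have h2 : 0 < max (sigmaSq Λ) d := lt_max_of_lt_right (by exact_mod_cast hd)
  have h3 : (0 : ℝ) < m := by exact_mod_cast hm
  rw [constBeta]
  positivity

/-- A tail bound `m (C r + a) x` for a probability needs a proof only if `m a x ≤ 1`. -/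
theorem le_ofReal_of_le_of_mul_le_one {Ω : Type*} [MeasurableSpace Ω] {P : Measure Ω}
    [IsProbabilityMeasure P] {A : Set Ω} {m C r a x : ℝ}
    (h : m * a * x ≤ 1 → P A ≤ ENNReal.ofReal (m * ((C * r + a) * x)))
    (hm : 1 ≤ m) (hC : 0 ≤ C) (hr : 0 ≤ r) (hx : 0 ≤ x) :
    P A ≤ ENNReal.ofReal (m * ((C * r + a) * x)) := by
  rcases le_or_gt (m * a * x) 1 with hle | hgt
  · exact h hle
  · refine prob_le_one.trans (ENNReal.one_le_ofReal.2 ?_)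
    have : 0 ≤ m * (C * r * x) := by positivity
    nlinarith

end Constants

end RFSF

end

theorem theorem1 {d : ℕ} (hd : 1 ≤ d)
    -- the kernel `k`, its reproducing kernel Hilbert space `H` and its spectral measure `Λ`
    (k : EuclideanSpace ℝ (Fin d) → EuclideanSpace ℝ (Fin d) → ℝ)
    (H : Type*) [NormedAddCommGroup H] [InnerProductSpace ℝ H] [CompleteSpace H]
    [RKHS ℝ H (EuclideanSpace ℝ (Fin d)) ℝ]
    (hH : ∀ x y, RKHS.kernel H x y (1 : ℝ) = k x y)
    (hcont : Continuous fun p : EuclideanSpace ℝ (Fin d) × EuclideanSpace ℝ (Fin d) => k p.1 p.2)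
    (hbdd : ∃ B : ℝ, ∀ x y, |k x y| ≤ B)
    (htrans : ∀ x y z, k (x + z) (y + z) = k x y)
    (Λ : Measure (EuclideanSpace ℝ (Fin d))) [IsProbabilityMeasure Λ]
    (hΛ : RFSF.IsSpectralMeasure k Λ)
    (S R : ℝ) (hS : 0 < S) (hR : 0 < R) (hB : RFSF.BernsteinCondition Λ S R)
    (X : Set (EuclideanSpace ℝ (Fin d))) (hXc : IsCompact X) (hXconv : Convex ℝ X) :
    -- the quantities that enter the bound are well defined and finite
    (Integrable (fun w : EuclideanSpace ℝ (Fin d) => ‖w‖ ^ 2) Λ ∧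
      (∀ i j : Fin d, Integrable (fun w : EuclideanSpace ℝ (Fin d) => w i * w j) Λ) ∧
      (∀ i j : Fin d, Integrable (fun w : EuclideanSpace ℝ (Fin d) => |w i * w j| * ‖w‖) Λ) ∧
      ContDiff ℝ 3 (fun z => k z 0) ∧
      (∀ i j : Fin d, BddAbove (RFSF.gradNorm k i j '' (X - X)))) ∧
    -- the concentration inequality
    (∀ (V : ℝ), 0 < V → ∀ (m D : ℕ), 1 ≤ m → 1 ≤ D →
      ∀ (Ω : Type*) [MeasurableSpace Ω] (P : Measure Ω) [IsProbabilityMeasure P]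
        (W : Fin m → Fin D → Ω → EuclideanSpace ℝ (Fin d)),
        (∀ p j, Measurable (W p j)) →
        iIndepFun (fun q : Fin m × Fin D => W q.1 q.2) P →
        (∀ p j, P.map (W p j) = Λ) →
        ∀ ε : ℝ, 0 < ε →
          P {ω | ENNReal.ofReal ε ≤ RFSF.uniformError H X V (fun p j => W p j ω)} ≤
            ENNReal.ofReal (RFSF.tailBound d m D (RFSF.constC k Λ X) S R
              (RFSF.constBeta Λ m V) ε)) := by
  have hsq := hB.integrable_norm_pow (n := 2) (by norm_num)
  refine ⟨⟨hsq, RFSF.integrable_apply_mul_apply hsq, hB.integrable_abs_mul_norm, hB.contDiff hΛ,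
    fun i j => RFSF.bddAbove_gradNorm hB hΛ i j _⟩, ?_⟩
  intro V hV m D hm hD Ω _ P _ W hW hind hlaw ε hε
  have hm' : (1 : ℝ) ≤ m := by exact_mod_cast hm
  set b := RFSF.constBeta Λ m V with hb
  set C := RFSF.constC k Λ X with hC
  have hC0 : 0 ≤ C := RFSF.constC_nonneg k Λ X
  have hb0 : 0 < b := RFSF.constBeta_pos hd hm hV
  rw [RFSF.tailBound]
  split_ifs with hlt
  · -- Small deviations: entries are controlled up to `2 t`, second moments up to a factor `2`.
    set t := ε / b with ht
    have ht0 : 0 < t := by positivity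
    have ht1 : t ≤ 1 := ((div_lt_one hb0).2 hlt).le
    set x := Real.exp (-(D / (2 * (d + 1) * (S ^ 2 + R)) * t ^ 2)) with hx
    have hx0 : 0 ≤ x := (Real.exp_pos _).le
    have hx1 : x ≤ 1 := Real.exp_le_one_iff.2 (neg_nonpos.2 (by positivity))
    have hinv : b / ε = 1 / t := by rw [ht, one_div_div]
    rw [hinv]
    have hp : Real.exp (-(D * (t ^ 2 / (2 * (S ^ 2 + R * t))))) ≤ x ^ (d + 1) := by
      rw [hx, ← Real.exp_nat_mul, Real.exp_le_exp]
      have h1 : ((d + 1 : ℕ) : ℝ) * -(D / (2 * (d + 1) * (S ^ 2 + R)) * t ^ 2)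
          = -(D * (t ^ 2 / (2 * (S ^ 2 + R * 1)))) := by
        push_cast; field_simp
      rw [h1]
      gcongr
    refine RFSF.le_ofReal_of_le_of_mul_le_one (fun hle => ?_) hm' hC0 (by positivity) hx0
    refine (RFSF.measure_uniformError_ge_le hd hm hD hH hS hR hB hΛ hXc hXconv hW hind hlaw
      (θ := 1) ht0 ht1 le_rfl hV hε hp (le_of_eq ?_)).trans (ENNReal.ofReal_le_ofReal ?_)
    · rw [← hb, ht]; field_simp; simp
    · rw [RFSF.sum_netBound_eq Λ k X hx0 ht0]
      have : 2 * (d : ℝ) ^ 2 * x ^ (d + 1) ≤ RFSF.addConst d m * x := by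
        by_cases hdm : d = 1 ∧ m = 1
        · rw [RFSF.addConst, if_pos hdm, hdm.1]
          have : x ^ 2 ≤ x := by nlinarith
          norm_num
          linarith
        · rw [RFSF.addConst, if_neg hdm] at hle ⊢
          exact RFSF.two_mul_sq_mul_pow_le hd hm hdm hx0 hle
      rw [add_mul]
      gcongr
  · -- Large deviations: entries and second moments are controlled up to the same factor `2 θ`.
    have hm0 : (m : ℝ) ≠ 0 := by positivity
    set θ := (ε / b) ^ ((1 : ℝ) / m) with hθ
    have hθ1 : 1 ≤ θ :=
      Real.one_le_rpow ((one_le_div hb0).2 (not_lt.1 hlt)) (by positivity)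
    have hθ0 : 0 < θ := by linarith
    have hθm : θ ^ m = ε / b := by
      rw [hθ, one_div, Real.rpow_inv_natCast_pow (by positivity) (by omega)]
    set x := Real.exp (-(D / (2 * (d + 1) * (S ^ 2 + R)) * θ)) with hx
    have hx0 : 0 ≤ x := (Real.exp_pos _).le
    have hx1 : x ≤ 1 := Real.exp_le_one_iff.2 (neg_nonpos.2 (by positivity))
    have hinv : (b / ε) ^ ((d : ℝ) / ((d + 1) * m)) = (1 / θ) ^ ((d : ℝ) / (d + 1)) := by
      rw [hθ, one_div ((ε / b) ^ _), ← Real.inv_rpow (by positivity), inv_div,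
        ← Real.rpow_mul (by positivity)]
      congr 1
      field_simp
    rw [hinv]
    have hp : ∀ τ, θ ≤ τ →
        Real.exp (-(D * (τ ^ 2 / (2 * (S ^ 2 + R * τ))))) ≤ x ^ (d + 1) := by
      intro τ hτ
      have hτ1 : 1 ≤ τ := hθ1.trans hτ
      rw [hx, ← Real.exp_nat_mul, Real.exp_le_exp]
      have h1 : ((d + 1 : ℕ) : ℝ) * -(D / (2 * (d + 1) * (S ^ 2 + R)) * θ)
          = -(D * (θ / (2 * (S ^ 2 + R)))) := by
        push_cast; field_simp
      rw [h1]
      have h2 : θ / (2 * (S ^ 2 + R)) ≤ τ ^ 2 / (2 * (S ^ 2 + R * τ)) := by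
        refine (div_le_div_of_nonneg_right hτ (by positivity)).trans ?_
        rw [div_le_div_iff₀ (by positivity) (by positivity)]
        have : S ^ 2 * τ ≤ S ^ 2 * (τ * τ) := by
          gcongr
          exact le_mul_of_one_le_left (by positivity) hτ1
        nlinarith
      gcongr
    refine RFSF.le_ofReal_of_le_of_mul_le_one (fun hle => ?_) hm' hC0 (by positivity) hx0
    have hεb : RFSF.constBeta Λ m V * θ ^ m ≤ ε := by
      rw [hθm, ← hb, mul_div_cancel₀ _ hb0.ne']
    by_cases hdm : d = 1 ∧ m = 1
    · obtain ⟨rfl, rfl⟩ := hdm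
      refine (RFSF.measure_uniformError_ge_le_of_dim_one hD hH hS hR hB hΛ hXc hXconv hW hind hlaw
        hθ1 hV hε hp (by simpa using hεb)).trans (ENNReal.ofReal_le_ofReal ?_)
      rw [RFSF.sum_netBound_eq Λ k X hx0 hθ0]
      have : x ^ (1 + 1) ≤ x := pow_le_of_le_one hx0 hx1 (by norm_num)
      rw [Nat.cast_one (R := ℝ), one_mul, add_mul, one_mul]
      gcongr
    · refine (RFSF.measure_uniformError_ge_le hd hm hD hH hS hR hB hΛ hXc hXconv hW hind hlaw
        hθ0 le_rfl hθ1 hV hε (hp θ le_rfl) ?_).trans (ENNReal.ofReal_le_ofReal ?_)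
      · rwa [div_self hθ0.ne', mul_one]
      · rw [RFSF.sum_netBound_eq Λ k X hx0 hθ0]
        have := RFSF.two_mul_sq_mul_pow_le hd hm hdm hx0 hle
        rw [add_mul]
        gcongr
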